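/- Let $M$ be an oriented smooth Riemannian manifold of dimension $3$ with volume form $dV$. Let $\star$ be the Hodge star ($\alpha\wedge\star\beta=\langle\alpha,\beta\rangle\,dV$), let $\flat,\sharp$ be the musical isomorphisms between vector fields and $1$-forms, and let $\delta=(-1)^{3i+1}\star d\star:\Omega^i(M)\to\Omega^{i-1}(M)$. For vector fields put $\operatorname{div}u=\delta(u^\flat)$, $\operatorname{curl}u=(\star\,du^\flat)^\sharp$, and let $(v\cdot\nabla)u=\nabla_vu$ be the Levi-Civita covariant derivative. Let $\varepsilon$ and $dt$ have degree $-1$ and $t$ degree $0$, with $d(t)=dt$ and $d(dt)=d(\varepsilon)=0$. A collection of homotopy random variables parametrized by $R$, where $R=\mathbb R[\varepsilon]$ or $R=\mathbb R[\varepsilon][t,dt]$, is an element $\mathcal X$ of degree zero of the graded commutative algebra $\Omega^\bullet(M)\otimes R$ (a $k$-form has degree $k$) such that $(\delta\otimes1+1\otimes d)\exp(\mathcal X)=0$, with the usual Koszul signs. A homotopy of $\mathbb R[\varepsilon]$-collections is a collection parametrized by $\mathbb R[\varepsilon][t,dt]$; it is a homotopy between its values at $dt=0$ and given times $t$, which are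 $\mathbb R[\varepsilon]$-collections. It has the form $$f(t)+X(t)\,dt+V(t)\,\varepsilon+\pi(t)\,dt\,\varepsilon$$ with $f,X,V,\pi$ time-dependent smooth forms of degree $0,1,1,2$. "Time-dependent" is understood in either of the following two senses, used throughout: (i) formal power series in $t$ with smooth coefficients (which can be evaluated at $t=0$); (ii) smooth functions of $(t,x)\in J\times M$, for a fixed nondegenerate interval $J\subseteq\mathbb R$ (which can be evaluated at all $t\in J$). In both senses the following holds. (a) Let $u(t)$ be a time-dependent smooth vector field that solves the vorticity equations of a nonviscous fluid with unit density $$\dot\omega=(\omega\cdot\nabla)u-(u\cdot\nabla)\omega,\qquad \operatorname{div}u=0,\qquad \omega=\operatorname{curl}u .$$ Then $f=0$, $X=u^\flat$, $V=-\star dX$, $\pi=\tfrac12\delta(X\wedge\star X)$ define a homotopy of $\mathbb R[\varepsilon]$-collections of homotopy random variables. (b) Conversely, every homotopy $f+X\,dt+V\varepsilon+\pi\,dt\,\varepsilon$ of $\mathbb R[\varepsilon]$-collections of homotopy random variables with $$f=0,\qquad V=-\star dX,\qquad \pi=\tfrac12\delta(X\wedge\star X)$$ (density, vorticity and kinetic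 constraints) arises as in (a) from a solution $u$ of the vorticity equations, with velocity $u=X^\sharp$. -/

import Mathlib

open scoped Manifold ContDiff Bundle

noncomputable section

namespace HPT

/-! ### Differential forms and vector fields on a 3-manifold -/

section Forms

variable (M : Type*) [TopologicalSpace M] [ChartedSpace (EuclideanSpace ℝ (Fin 3)) M]

/-- Fields of alternating `k`-forms on the tangent spaces (smoothness is a separate predicate). -/
abbrev Form (k : ℕ) := ∀ x : M, (TangentSpace (𝓡 3) x) [⋀^Fin k]→L[ℝ] ℝ

/-- Fields of tangent vectors (smoothness is a separate predicate). -/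
abbrev VField := ∀ x : M, TangentSpace (𝓡 3) x

variable {M}

/-- The expression of a `k`-form in the preferred chart `φ` at `x₀`, i.e. its pullback
by `φ⁻¹`, as a form on (the target of the chart in) `ℝ³`. -/
def chartRep {k : ℕ} (x₀ : M) (α : Form M k) (y : EuclideanSpace ℝ (Fin 3)) :
    (EuclideanSpace ℝ (Fin 3)) [⋀^Fin k]→L[ℝ] ℝ :=
  (α ((extChartAt (𝓡 3) x₀).symm y)).compContinuousLinearMap
    (mfderiv 𝓘(ℝ, EuclideanSpace ℝ (Fin 3)) (𝓡 3) (extChartAt (𝓡 3) x₀).symm y)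

/-- A form is smooth if it is so in all preferred charts. -/
def IsSmoothForm {k : ℕ} (α : Form M k) : Prop :=
  ∀ x₀ : M, ContDiffOn ℝ ∞ (chartRep x₀ α) (extChartAt (𝓡 3) x₀).target

/-- The exterior derivative: at `x`, pass to the preferred chart at `x`, take the exterior
derivative in `ℝ³`, and pull back. -/
def extD {k : ℕ} (α : Form M k) : Form M (k + 1) := fun x =>
  (extDeriv (chartRep x α) (extChartAt (𝓡 3) x x)).compContinuousLinearMap
    (mfderiv (𝓡 3) 𝓘(ℝ, EuclideanSpace ℝ (Fin 3)) (extChartAt (𝓡 3) x) x)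

end Forms

section LinearAlgebra

variable {W : Type*} [AddCommGroup W] [Module ℝ W] [TopologicalSpace W]

/-- The multilinear map `v ↦ α (v₀, …, v_{p-1}) β (v_p, …, v_{p+q-1})`. -/
def tensorMul {p q k : ℕ} (h : p + q = k) (α : W [⋀^Fin p]→L[ℝ] ℝ) (β : W [⋀^Fin q]→L[ℝ] ℝ) :
    ContinuousMultilinearMap ℝ (fun _ : Fin k => W) ℝ where
  toMultilinearMap := ((LinearMap.mul' ℝ ℝ).compMultilinearMap
    (α.toMultilinearMap.domCoprod β.toMultilinearMap)).domDomCongr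
      (finSumFinEquiv.trans (finCongr h))
  cont := by
    change Continuous fun v : Fin k → W =>
      α (fun i => v (finCongr h (finSumFinEquiv (Sum.inl i)))) *
        β (fun i => v (finCongr h (finSumFinEquiv (Sum.inr i))))
    exact (α.cont.comp (by fun_prop)).mul (β.cont.comp (by fun_prop))

theorem tensorMul_apply {p q k : ℕ} (h : p + q = k) (α : W [⋀^Fin p]→L[ℝ] ℝ)
    (β : W [⋀^Fin q]→L[ℝ] ℝ) (v : Fin k → W) :
    tensorMul h α β v = α (fun i => v (Fin.cast h (Fin.castAdd q i))) *
      β (fun i => v (Fin.cast h (Fin.natAdd p i))) := rfl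

/-- The wedge product `α ∧ β = (1 / (p! q!)) ∑ σ, sign σ • σ (α ⊗ β)` of alternating forms. -/
def wedge {p q k : ℕ} (h : p + q = k) (α : W [⋀^Fin p]→L[ℝ] ℝ) (β : W [⋀^Fin q]→L[ℝ] ℝ) :
    W [⋀^Fin k]→L[ℝ] ℝ :=
  ((p.factorial : ℝ) * (q.factorial : ℝ))⁻¹ •
    ContinuousMultilinearMap.alternatization (tensorMul h α β)

theorem wedge_apply {p q k : ℕ} (h : p + q = k) (α : W [⋀^Fin p]→L[ℝ] ℝ)
    (β : W [⋀^Fin q]→L[ℝ] ℝ) (v : Fin k → W) :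
    wedge h α β v = ((p.factorial : ℝ) * (q.factorial : ℝ))⁻¹ *
      ∑ σ : Equiv.Perm (Fin k), Equiv.Perm.sign σ •
        (α (fun i => v (σ (Fin.cast h (Fin.castAdd q i)))) *
          β (fun i => v (σ (Fin.cast h (Fin.natAdd p i))))) := by
  simp [wedge, ContinuousMultilinearMap.alternatization_apply_apply, tensorMul_apply]

end LinearAlgebra

section Contract

/-- The same form, with its slots indexed by `Fin k` instead of `Fin m`, `m = k`. -/
def castForm {W : Type*} [AddCommGroup W] [Module ℝ W] [TopologicalSpace W] {m k : ℕ} (h : m = k)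
    (η : W [⋀^Fin m]→L[ℝ] ℝ) : W [⋀^Fin k]→L[ℝ] ℝ :=
  { η.toContinuousMultilinearMap.domDomCongr (finCongr h) with
    map_eq_zero_of_eq' := fun v i j hv hij =>
      η.map_eq_zero_of_eq (fun a => v (finCongr h a)) (i := (finCongr h).symm i)
        (j := (finCongr h).symm j) (by simpa using hv) (by simpa using hij) }

theorem castForm_apply {W : Type*} [AddCommGroup W] [Module ℝ W] [TopologicalSpace W] {m k : ℕ}
    (h : m = k) (η : W [⋀^Fin m]→L[ℝ] ℝ) (v : Fin k → W) :
    castForm h η v = η (fun a => v (Fin.cast h a)) := rfl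

variable {W : Type*} [NormedAddCommGroup W] [NormedSpace ℝ W]

/-- Insert `k` vectors into the first `k` slots: `contract k η w v = η (w₀, …, w_{k-1}, v)`. -/
def contract {l : ℕ} : (k : ℕ) → (W [⋀^Fin (l + k)]→L[ℝ] ℝ) → (Fin k → W) → (W [⋀^Fin l]→L[ℝ] ℝ)
  | 0, η, _ => η
  | k + 1, η, w => contract k (η.curryLeft (w 0)) (Fin.tail w)

end Contract

/-- The wedge product of differential forms. -/
def wedgeForm {M : Type*} [TopologicalSpace M] [ChartedSpace (EuclideanSpace ℝ (Fin 3)) M]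
    {p q k : ℕ} (h : p + q = k) (α : Form M p) (β : Form M q) : Form M k :=
  fun x => wedge h (α x) (β x)

/-! ### Riemannian geometry of an oriented 3-manifold -/

section Riemannian

variable {M : Type*} [TopologicalSpace M] [ChartedSpace (EuclideanSpace ℝ (Fin 3)) M]

instance finrankFact (x : M) : Fact (Module.finrank ℝ (TangentSpace (𝓡 3) x) = 3) :=
  ⟨(finrank_euclideanSpace_fin : Module.finrank ℝ (EuclideanSpace ℝ (Fin 3)) = 3)⟩

instance finiteDimensionalTangent (x : M) : FiniteDimensional ℝ (TangentSpace (𝓡 3) x) :=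
  inferInstanceAs (FiniteDimensional ℝ (EuclideanSpace ℝ (Fin 3)))

variable [Bundle.RiemannianBundle (fun x : M => TangentSpace (𝓡 3) x)]

/-- An orthonormal basis of the tangent space at `x`. -/
def frame (x : M) : OrthonormalBasis (Fin (Module.finrank ℝ (TangentSpace (𝓡 3) x))) ℝ
    (TangentSpace (𝓡 3) x) :=
  stdOrthonormalBasis ℝ (TangentSpace (𝓡 3) x)

/-- The musical isomorphism `u ↦ u^♭ = ⟨u, ·⟩`. -/
def flat (u : VField M) : Form M 1 := fun x =>
  ContinuousAlternatingMap.ofSubsingleton ℝ (TangentSpace (𝓡 3) x) ℝ (0 : Fin 1)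
    (innerSL ℝ (u x))

/-- The musical isomorphism `α ↦ α^♯`, the inverse of `flat`. -/
def sharp (α : Form M 1) : VField M := fun x =>
  ∑ i, α x (fun _ => frame x i) • frame x i

theorem sharp_flat (u : VField M) : sharp (flat u) = u := by
  funext x
  have h := (frame x).sum_repr' (u x)
  simp only [sharp, flat, ContinuousAlternatingMap.ofSubsingleton_apply_apply,
    innerSL_apply_apply]
  simpa only [real_inner_comm] using h

theorem flat_sharp (α : Form M 1) : flat (sharp α) = α := by
  funext x
  ext v
  obtain ⟨f, hf⟩ := (ContinuousAlternatingMap.ofSubsingleton ℝ (TangentSpace (𝓡 3) x) ℝ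
    (0 : Fin 1)).surjective (α x)
  have h := congrArg f ((frame x).sum_repr' (v 0))
  rw [map_sum] at h
  simp only [map_smul, smul_eq_mul] at h
  simp only [sharp, flat, ← hf, ContinuousAlternatingMap.ofSubsingleton_apply_apply,
    innerSL_apply_apply, sum_inner, real_inner_smul_left]
  rw [← h]
  exact Finset.sum_congr rfl fun (i : Fin (Module.finrank ℝ (TangentSpace (𝓡 3) x))) _ =>
    mul_comm (f (frame x i)) (inner ℝ (frame x i) (v 0))

/-- The Riemannian volume form `dV` of an orientation of the tangent spaces. -/
def volForm (o : ∀ x : M, Orientation ℝ (TangentSpace (𝓡 3) x) (Fin 3)) : Form M 3 := fun x =>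
  AlternatingMap.mkContinuous (o x).volumeForm 1 (fun v => by
    simpa using (o x).abs_volumeForm_apply_le v)

/-- The Hodge star `⋆ : Ω^k → Ω^l`, `k + l = 3`: with an orthonormal basis `e`,
`(⋆β)(v) = (1 / k!) ∑_J β(e_{J 1}, …, e_{J k}) dV(e_{J 1}, …, e_{J k}, v)`. It is characterized by
`α ∧ ⋆β = ⟨α, β⟩ dV`. -/
def star (o : ∀ x : M, Orientation ℝ (TangentSpace (𝓡 3) x) (Fin 3)) {k l : ℕ} (h : l + k = 3)
    (β : Form M k) : Form M l := fun x =>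
  (k.factorial : ℝ)⁻¹ •
    ∑ J : Fin k → Fin (Module.finrank ℝ (TangentSpace (𝓡 3) x)),
      β x (fun j => frame x (J j)) •
        contract k (castForm h.symm (volForm o x)) (fun j => frame x (J j))

/-- The codifferential `δ = (-1)^{3i+1} ⋆ d ⋆ : Ω^i → Ω^{i-1}`, `i = k + 1`
(there are no nonzero forms of degree greater than `3`). -/
def codiff (o : ∀ x : M, Orientation ℝ (TangentSpace (𝓡 3) x) (Fin 3)) {k : ℕ}
    (α : Form M (k + 1)) : Form M k :=
  if h : k + 1 ≤ 3 then
    (-1 : ℝ) ^ (3 * (k + 1) + 1) •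
      star o (show k + ((2 - k) + 1) = 3 by omega)
        (extD (star o (show (2 - k) + (k + 1) = 3 by omega) α))
  else 0

/-- `div u = δ(u^♭)`, a function, i.e. a `0`-form. -/
def divergence (o : ∀ x : M, Orientation ℝ (TangentSpace (𝓡 3) x) (Fin 3)) (u : VField M) :
    Form M 0 :=
  codiff o (flat u)

/-- `curl u = (⋆ d u^♭)^♯`. -/
def curl (o : ∀ x : M, Orientation ℝ (TangentSpace (𝓡 3) x) (Fin 3)) (u : VField M) : VField M :=
  sharp (star o (show 1 + 2 = 3 from rfl) (extD (flat u)))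

/-- The coefficient `⟨∂_v, ∂_w⟩` of the metric in the preferred chart at `x₀`, as a function on
(the target of the chart in) `ℝ³`. -/
def metricRep (x₀ : M) (v w : EuclideanSpace ℝ (Fin 3)) (y : EuclideanSpace ℝ (Fin 3)) : ℝ :=
  inner ℝ
    (mfderiv 𝓘(ℝ, EuclideanSpace ℝ (Fin 3)) (𝓡 3) (extChartAt (𝓡 3) x₀).symm y v)
    (mfderiv 𝓘(ℝ, EuclideanSpace ℝ (Fin 3)) (𝓡 3) (extChartAt (𝓡 3) x₀).symm y w)

/-- The expression of a vector field in the preferred chart at `x₀`. -/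
def vfieldRep (x₀ : M) (u : VField M) (y : EuclideanSpace ℝ (Fin 3)) : EuclideanSpace ℝ (Fin 3) :=
  mfderiv (𝓡 3) 𝓘(ℝ, EuclideanSpace ℝ (Fin 3)) (extChartAt (𝓡 3) x₀)
    ((extChartAt (𝓡 3) x₀).symm y) (u ((extChartAt (𝓡 3) x₀).symm y))

/-- The coordinates of a tangent vector at `x` in the preferred chart at `x`. -/
def coords (x : M) (v : TangentSpace (𝓡 3) x) : EuclideanSpace ℝ (Fin 3) :=
  mfderiv (𝓡 3) 𝓘(ℝ, EuclideanSpace ℝ (Fin 3)) (extChartAt (𝓡 3) x) x v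

/-- The Christoffel symbol of the first kind at `x` in the preferred chart at `x`:
`(∂_v g(w, z) + ∂_w g(v, z) - ∂_z g(v, w)) / 2`. -/
def christoffel (x : M) (v w z : TangentSpace (𝓡 3) x) : ℝ :=
  (1 / 2 : ℝ) *
    (fderiv ℝ (metricRep x (coords x w) (coords x z)) (extChartAt (𝓡 3) x x) (coords x v)
      + fderiv ℝ (metricRep x (coords x v) (coords x z)) (extChartAt (𝓡 3) x x) (coords x w)
      - fderiv ℝ (metricRep x (coords x v) (coords x w)) (extChartAt (𝓡 3) x x) (coords x z))

/-- The Levi-Civita covariant derivative `(v ⋅ ∇) u = ∇_v u`: at `x`, in the preferred chart at `x`,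
it is `∂_v u + Γ(v, u)`. -/
def covD (v u : VField M) : VField M := fun x =>
  (mfderiv (𝓡 3) 𝓘(ℝ, EuclideanSpace ℝ (Fin 3)) (extChartAt (𝓡 3) x) x).inverse
      (fderiv ℝ (vfieldRep x u) (extChartAt (𝓡 3) x x) (coords x (v x)))
    + ∑ i, christoffel x (v x) (u x) (frame x i) • frame x i

end Riemannian

/-! ### Time dependence -/

/-- The coefficient algebras for the time parameter: no time at all; formal power series in `t`;
smooth functions of `t` in a set `J` of real numbers (an interval). -/
inductive TimeDomain : Type
  | point : TimeDomain
  | formal : TimeDomain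
  | interval (J : Set ℝ) : TimeDomain

namespace TimeDomain

/-- A time-dependent element of `A` is a map `τ.Index → A`: an element of `A`, the
sequence of the coefficients of a power series, or a function of time. -/
def Index : TimeDomain → Type
  | point => Unit
  | formal => ℕ
  | interval _ => ℝ

/-- The indices that matter: functions of time are only considered on `J`. -/
def dom : (τ : TimeDomain) → Set τ.Index
  | point => (Set.univ : Set Unit)
  | formal => (Set.univ : Set ℕ)
  | interval J => J

/-- The values of `t` at which a time-dependent element can be evaluated. They are given as indices:
the value of a power series at `t = 0` is its coefficient of index `0`. -/
def evalTimes : (τ : TimeDomain) → Set τ.Index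
  | point => (Set.univ : Set Unit)
  | formal => ({0} : Set ℕ)
  | interval J => J

/-- The admissible ranges of time for a motion: formal time, and all nondegenerate intervals. -/
def IsTime : TimeDomain → Prop
  | point => False
  | formal => True
  | interval J => Convex ℝ J ∧ (interior J).Nonempty

/-- The constant function of time with value `a`. -/
def const {A : Type*} [Zero A] : (τ : TimeDomain) → A → τ.Index → A
  | point, a => fun _ => a
  | formal, a => fun n : ℕ => if n = 0 then a else 0
  | interval _, a => fun _ => a

/-- The extension of a bilinear operation to time-dependent elements: the Cauchy product
for power series, and the pointwise operation for functions of time. -/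
def lift {A B C : Type*} [AddCommMonoid C] (op : A → B → C) :
    (τ : TimeDomain) → (τ.Index → A) → (τ.Index → B) → τ.Index → C
  | point, a, b => fun i => op (a i) (b i)
  | formal, a, b => fun n : ℕ => ∑ ij ∈ Finset.HasAntidiagonal.antidiagonal n, op (a ij.1) (b ij.2)
  | interval _, a, b => fun t => op (a t) (b t)

/-- The time derivative of a time-dependent section. -/
def ddt {X : Type*} {F : X → Type*} [∀ x, NormedAddCommGroup (F x)] [∀ x, NormedSpace ℝ (F x)] :
    (τ : TimeDomain) → (τ.Index → ∀ x, F x) → τ.Index → ∀ x, F x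
  | point, _ => fun _ => 0
  | formal, a => fun (n : ℕ) x => ((n : ℝ) + 1) • a ((n + 1 : ℕ)) x
  | interval J, a => fun (t : ℝ) x => derivWithin (fun s : ℝ => a s x) J t

variable {M : Type*} [TopologicalSpace M] [ChartedSpace (EuclideanSpace ℝ (Fin 3)) M]

/-- Smoothness of a time-dependent form: of all coefficients for power series,
jointly in time and space for functions of time. -/
def SmoothForm {k : ℕ} : (τ : TimeDomain) → (τ.Index → Form M k) → Prop
  | point, a => ∀ i : Unit, IsSmoothForm (a i)
  | formal, a => ∀ n : ℕ, IsSmoothForm (a n)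
  | interval J, a => ∀ x₀ : M,
      ContDiffOn ℝ ∞ (fun p : ℝ × EuclideanSpace ℝ (Fin 3) => chartRep x₀ (a p.1) p.2)
        (J ×ˢ (extChartAt (𝓡 3) x₀).target)

/-- Smoothness of a time-dependent vector field. -/
def SmoothVField [IsManifold (𝓡 3) ∞ M] : (τ : TimeDomain) → (τ.Index → VField M) → Prop
  | point, u => ∀ i : Unit,
      ContMDiff (𝓡 3) (𝓡 3).tangent ∞ (fun x => (⟨x, u i x⟩ : TangentBundle (𝓡 3) M))
  | formal, u => ∀ n : ℕ,
      ContMDiff (𝓡 3) (𝓡 3).tangent ∞ (fun x => (⟨x, u n x⟩ : TangentBundle (𝓡 3) M))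
  | interval J, u =>
      ContMDiffOn (𝓘(ℝ, ℝ).prod (𝓡 3)) (𝓡 3).tangent ∞
        (fun p : ℝ × M => (⟨p.2, u p.1 p.2⟩ : TangentBundle (𝓡 3) M))
        (J ×ˢ (Set.univ : Set M))

end TimeDomain

/-! ### The algebra `Ω^•(M) ⊗ ℝ[ε][t, dt]` and collections of homotopy random variables -/

/-- Elements of `Ω^•(M) ⊗ ℝ[ε][t, dt]`, with `ε` and `dt` of degree `-1` (hence of square `0`),
and with functions of `t` as specified by `τ`. The coefficient of `dt^a ε^b` (parameters are written
to the right of forms) in form degree `k` is `Y a b k`. -/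
abbrev Elt (M : Type*) [TopologicalSpace M] [ChartedSpace (EuclideanSpace ℝ (Fin 3)) M]
    (τ : TimeDomain) :=
  ∀ (_ _ : Fin 2) (k : ℕ), τ.Index → Form M k

namespace Elt

variable {M : Type*} [TopologicalSpace M] [ChartedSpace (EuclideanSpace ℝ (Fin 3)) M]
variable {τ : TimeDomain}

/-- The unit. -/
def one : Elt M τ := fun a b k =>
  match a, b, k with
  | 0, 0, 0 => τ.const (fun x =>
      ContinuousAlternatingMap.constOfIsEmpty ℝ (TangentSpace (𝓡 3) x) (Fin 0) (1 : ℝ))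
  | _, _, _ => fun _ => 0

/-- The product, with the Koszul sign
`(α dt^a ε^b) (β dt^a' ε^b') = (-1)^(|β| (a + b) + b a') (α ∧ β) dt^(a + a') ε^(b + b')`. -/
def mul (Y Z : Elt M τ) : Elt M τ := fun a b k =>
  ∑ a₁ ∈ Finset.Iic a, ∑ b₁ ∈ Finset.Iic b, ∑ pq ∈ (Finset.HasAntidiagonal.antidiagonal k).attach,
    (-1 : ℝ) ^ (pq.1.2 * ((a₁ : ℕ) + (b₁ : ℕ)) + (b₁ : ℕ) * ((a - a₁ : Fin 2) : ℕ)) •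
      τ.lift (wedgeForm (Finset.HasAntidiagonal.mem_antidiagonal.1 pq.2)) (Y a₁ b₁ pq.1.1)
        (Z (a - a₁) (b - b₁) pq.1.2)

/-- Powers. -/
def npow (Y : Elt M τ) : ℕ → Elt M τ
  | 0 => one
  | n + 1 => mul (npow Y n) Y

/-- The element `f + X dt + V ε + P dt ε`. -/
def ofComponents (f : τ.Index → Form M 0) (X V : τ.Index → Form M 1) (P : τ.Index → Form M 2) :
    Elt M τ := fun a b k =>
  match a, b, k with
  | 0, 0, 0 => f
  | 1, 0, 1 => X
  | 0, 1, 1 => V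
  | 1, 1, 2 => P
  | _, _, _ => fun _ => 0

/-- The evaluation at a value of `t` and at `dt = 0`, an element of `Ω^•(M) ⊗ ℝ[ε]`. -/
def slice (Y : Elt M τ) (s : τ.Index) : Elt M TimeDomain.point := fun a b k _ =>
  if a = 0 then Y 0 b k s else 0

variable [Bundle.RiemannianBundle (fun x : M => TangentSpace (𝓡 3) x)]

/-- The exponential series `∑ Yⁿ / n!`, summed pointwise in each coefficient. -/
def exp (Y : Elt M τ) : Elt M τ := fun a b k i x =>
  ∑' n : ℕ, (n.factorial : ℝ)⁻¹ • (npow Y n) a b k i x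

/-- The tensor product differential `δ ⊗ 1 + 1 ⊗ d`, where `d t = dt` and
`d dt = d ε = 0`, with the Koszul sign `(1 ⊗ d) (α ⊗ r) = (-1)^|α| α ⊗ d r`. -/
def diff (o : ∀ x : M, Orientation ℝ (TangentSpace (𝓡 3) x) (Fin 3)) (Y : Elt M τ) : Elt M τ :=
  fun a b k i => codiff o (Y a b (k + 1) i) +
    if a = 1 then (-1 : ℝ) ^ k • τ.ddt (Y 0 b k) i else 0

end Elt

section Homotopy

variable {M : Type*} [TopologicalSpace M] [ChartedSpace (EuclideanSpace ℝ (Fin 3)) M]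
  [Bundle.RiemannianBundle (fun x : M => TangentSpace (𝓡 3) x)]

/-- A collection of homotopy random variables: a degree zero element `Y`, with smooth coefficients,
such that `exp Y` is closed. The parameter ring is `ℝ[ε]` if `τ` is `point`
(then there is no `dt`), and `ℝ[ε][t, dt]` otherwise. -/
structure IsCollection (o : ∀ x : M, Orientation ℝ (TangentSpace (𝓡 3) x) (Fin 3))
    (τ : TimeDomain) (Y : Elt M τ) : Prop where
  smooth : ∀ a b k, τ.SmoothForm (Y a b k)
  no_dt : τ = TimeDomain.point → ∀ b k i, Y 1 b k i = 0
  degree_zero : ∀ i ∈ τ.dom, ∀ (a b : Fin 2) (k : ℕ), k ≠ (a : ℕ) + (b : ℕ) → Y a b k i = 0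
  closed : ∀ i ∈ τ.dom, ∀ a b k, Elt.diff o (Elt.exp Y) a b k i = 0

/-- A homotopy of `ℝ[ε]`-collections: a collection over `ℝ[ε][t, dt]`, whose values at
`dt = 0` and at given times are collections over `ℝ[ε]` (it is a homotopy between any two of those
values). -/
structure IsHomotopy (o : ∀ x : M, Orientation ℝ (TangentSpace (𝓡 3) x) (Fin 3))
    (τ : TimeDomain) (Y : Elt M τ) : Prop where
  collection : IsCollection o τ Y
  endpoints : ∀ s ∈ τ.evalTimes, IsCollection o TimeDomain.point (Y.slice s)

/-- `½ δ(X ∧ ⋆X)` for a time-dependent `1`-form `X`. -/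
def kinetic (o : ∀ x : M, Orientation ℝ (TangentSpace (𝓡 3) x) (Fin 3)) (τ : TimeDomain)
    (X : τ.Index → Form M 1) : τ.Index → Form M 2 := fun i =>
  (1 / 2 : ℝ) • codiff o
    (τ.lift (fun α β : Form M 1 =>
      wedgeForm (show 1 + 2 = 3 from rfl) α (star o (show 2 + 1 = 3 from rfl) β)) X X i)

/-- `- ⋆ dX` for a time-dependent `1`-form `X`. -/
def vorticityForm (o : ∀ x : M, Orientation ℝ (TangentSpace (𝓡 3) x) (Fin 3)) (τ : TimeDomain)
    (X : τ.Index → Form M 1) : τ.Index → Form M 1 := fun i =>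
  - star o (show 1 + 2 = 3 from rfl) (extD (X i))

/-- The element `f + X dt + V ε + π dt ε` with `f = 0`, `X = u^♭`, `V = - ⋆ dX`,
`π = ½ δ(X ∧ ⋆X)`. -/
def fluidElt (o : ∀ x : M, Orientation ℝ (TangentSpace (𝓡 3) x) (Fin 3)) (τ : TimeDomain)
    (u : τ.Index → VField M) : Elt M τ :=
  Elt.ofComponents (fun _ => 0) (fun i => flat (u i))
    (vorticityForm o τ (fun i => flat (u i))) (kinetic o τ (fun i => flat (u i)))

/-- Smooth solutions of the vorticity equations of a nonviscous fluid with unit density: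
`div u = 0` and `∂_t ω = (ω ⋅ ∇) u - (u ⋅ ∇) ω`, where `ω = curl u`. -/
structure IsVorticitySolution [IsManifold (𝓡 3) ∞ M]
    (o : ∀ x : M, Orientation ℝ (TangentSpace (𝓡 3) x) (Fin 3))
    (τ : TimeDomain) (u : τ.Index → VField M) : Prop where
  smooth : τ.SmoothVField u
  mass : ∀ i ∈ τ.dom, divergence o (u i) = 0
  vorticity : ∀ i ∈ τ.dom, τ.ddt (fun j => curl o (u j)) i =
    τ.lift covD (fun j => curl o (u j)) u i - τ.lift covD u (fun j => curl o (u j)) i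

end Homotopy

end HPT

end

set_option linter.unusedSectionVars false

noncomputable section

namespace HPT

-- Write ω = curl u. A degree zero element with f = 0 is Y = X dt + V ε + π dt ε. Since dt² = ε² =
-- 0, Y³ vanishes, and the Koszul signs make both cross terms of Y² equal to -X ∧ V dt ε. Hence exp
-- Y = 1 + X dt + V ε + (π - X ∧ V) dt ε, and closedness amounts to three equations
-- (`Elt.closed_iff`): δX = 0, δV = 0 and δ(π - X ∧ V) = ∂_t V.
--
-- Put X = u^♭ and V = -⋆dX = -ω^♭. The first equation is div u = 0. The second holds automatically,
-- because δ⋆d = ⋆d⋆⋆d = ⋆dd = 0 (`codiff_star_extD`). Likewise δπ = 0, because π is coexact and δδ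
-- = 0 (`codiff_kinetic`). What remains of the third is ∂_t ω^♭ = -δ(u^♭ ∧ ω^♭). For divergence-free
-- u and w one has -δ(u^♭ ∧ w^♭) = (∇_w u - ∇_u w)^♭ (`codiff_wedge_flat`), so the third equation is
-- the vorticity equation (`closed_dt_eps_iff`). All of this is an equivalence, which gives both
-- directions of the theorem.
--
-- The identity for δ(u^♭ ∧ w^♭) comes from ⋆(u^♭ ∧ w^♭) = dV(u, w, ⋅), from the Cartan formula for
-- the exterior derivative of this form, whose main term is dV([w, u], ⋅, ⋅) and whose other terms
-- contain div u and div w, and from ⋆dV(z, ⋅, ⋅) = z^♭. The bracket is ∇_w u - ∇_u w because the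
-- Christoffel symbols are symmetric.
--
-- The remaining work is regularity. `extD` uses a different chart at each point, and the frames
-- behind `star` and `sharp` are chosen point by point without continuity. So d is shown to commute
-- with chart representation (`chartRep_extD`), and ♯ and ⋆ are rewritten in charts through the
-- metric matrix and the density of dV. All senses of time are treated at once: a product is a
-- finite sum over pairs of indices (`TimeDomain.lift_eq_sum`), and div u = 0 holds at every index,
-- so the spatial identity applies to each pair.

local notation "𝔼" => EuclideanSpace ℝ (Fin 3)

/-! ### Linear algebra of the volume form and the Hodge star at a point -/

section

section Pointwise

theorem sum_fin_succ_fun {α A : Type*} [Fintype α] [AddCommMonoid A] {k : ℕ}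
    (F : (Fin (k + 1) → α) → A) : ∑ J, F J = ∑ a, ∑ J : Fin k → α, F (Fin.cons a J) := by
  rw [← (Fin.consEquiv fun _ : Fin (k + 1) => α).sum_comp, Fintype.sum_prod_type]
  rfl

/-- The determinant of three vectors given by their coordinates. -/
def det3 (a b c : Fin 3 → ℝ) : ℝ :=
  a 0 * (b 1 * c 2 - b 2 * c 1) - a 1 * (b 0 * c 2 - b 2 * c 0) + a 2 * (b 0 * c 1 - b 1 * c 0)

/-- The alternating 3-forms on a 3-dimensional space form a line, spanned by the determinant of a
basis. -/
theorem alt3_eq_det3 {W : Type*} [AddCommGroup W] [Module ℝ W] [TopologicalSpace W]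
    (Ω : W [⋀^Fin 3]→L[ℝ] ℝ) (b : Module.Basis (Fin 3) ℝ W) (v : Fin 3 → W) :
    Ω v = Ω ![b 0, b 1, b 2] * det3 (b.repr (v 0)) (b.repr (v 1)) (b.repr (v 2)) := by
  have h := AlternatingMap.eq_smul_basis_det b Ω.toAlternatingMap
  have h2 := congrArg (fun f => f v) h
  have hb : (![b 0, b 1, b 2] : Fin 3 → W) = b := by
    ext i; fin_cases i <;> rfl
  simp only [AlternatingMap.smul_apply, Module.Basis.det_apply, Matrix.det_fin_three,
    Module.Basis.toMatrix_apply] at h2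
  rw [hb]
  refine h2.trans ?_
  simp only [smul_eq_mul, det3]
  change Ω b * _ = _
  ring

variable {T : Type*} [NormedAddCommGroup T] [InnerProductSpace ℝ T]

theorem alt3_eq_orthonormal (Ω : T [⋀^Fin 3]→L[ℝ] ℝ) (e : OrthonormalBasis (Fin 3) ℝ T)
    (v : Fin 3 → T) :
    Ω v = Ω ![e 0, e 1, e 2] * det3 (fun i => inner ℝ (e i) (v 0)) (fun i => inner ℝ (e i) (v 1))
      (fun i => inner ℝ (e i) (v 2)) := by
  have h := alt3_eq_det3 Ω e.toBasis v
  have hr : ∀ w : T, (e.toBasis.repr w : Fin 3 → ℝ) = fun i => inner ℝ (e i) w := fun w => by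
    funext i
    rw [e.coe_toBasis_repr_apply, e.repr_apply_apply]
  simpa only [hr, OrthonormalBasis.coe_toBasis] using h

end Pointwise

variable {M : Type*} [TopologicalSpace M] [ChartedSpace (EuclideanSpace ℝ (Fin 3)) M]
  [Bundle.RiemannianBundle (fun x : M => TangentSpace (𝓡 3) x)]
  (o : ∀ x : M, Orientation ℝ (TangentSpace (𝓡 3) x) (Fin 3))

/-- The frame at `x`, indexed by `Fin 3`. -/
def frame3 (x : M) : OrthonormalBasis (Fin 3) ℝ (TangentSpace (𝓡 3) x) :=
  (frame x).reindex (finCongr (finrankFact x).out)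

/-- `frame x` is indexed by `Fin (finrank …)`, which is only propositionally `Fin 3`. Summing a
function of the vector, rather than of the index, avoids casts. -/
theorem sum_frame {A : Type*} [AddCommMonoid A] (x : M) (F : TangentSpace (𝓡 3) x → A) :
    ∑ i, F (frame x i) = ∑ i, F (frame3 x i) := by
  rw [← (finCongr (finrankFact x).out).symm.sum_comp]
  simp [frame3]

theorem volForm_apply (x : M) (v : Fin 3 → TangentSpace (𝓡 3) x) :
    volForm o x v = (o x).volumeForm v := rfl

/-- The volume of the frame at `x`, which is `1` or `-1`. -/
def frameSign (x : M) : ℝ := volForm o x ![frame3 x 0, frame3 x 1, frame3 x 2]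

theorem volForm_eq_det3 (x : M) (a b c : TangentSpace (𝓡 3) x) :
    volForm o x ![a, b, c] = frameSign o x * det3 (fun i => inner ℝ (frame3 x i) a)
      (fun i => inner ℝ (frame3 x i) b) (fun i => inner ℝ (frame3 x i) c) :=
  alt3_eq_orthonormal (volForm o x) (frame3 x) ![a, b, c]

theorem frameSign_sq (x : M) : frameSign o x * frameSign o x = 1 := by
  have h := (o x).abs_volumeForm_apply_of_orthonormal (frame3 x)
  have hb : (![frame3 x 0, frame3 x 1, frame3 x 2] : Fin 3 → TangentSpace (𝓡 3) x) = frame3 x := by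
    ext i; fin_cases i <;> rfl
  rw [frameSign, hb, volForm_apply, ← sq, ← sq_abs, h, one_pow]

theorem star_one_apply (h : 2 + 1 = 3) (β : Form M 1) (x : M) (v : Fin 2 → TangentSpace (𝓡 3) x) :
    star o h β x v = ∑ a, β x ![frame3 x a] * volForm o x ![frame3 x a, v 0, v 1] := by
  rw [← sum_frame x (fun w => β x ![w] * volForm o x ![w, v 0, v 1])]
  simp only [star, ContinuousAlternatingMap.smul_apply, ContinuousAlternatingMap.sum_apply]
  rw [sum_fin_succ_fun]
  simp only [Finset.univ_unique, Finset.sum_singleton, Nat.factorial_one, Nat.cast_one, inv_one,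
    one_smul]
  refine Finset.sum_congr rfl fun a _ => ?_
  rw [smul_eq_mul]
  congr 1
  · congr 1
    ext i; fin_cases i; rfl
  · change volForm o x _ = _
    congr 1
    ext i; fin_cases i <;> rfl

theorem star_two_apply (h : 1 + 2 = 3) (β : Form M 2) (x : M) (v : Fin 1 → TangentSpace (𝓡 3) x) :
    star o h β x v = 2⁻¹ * ∑ a, ∑ b, β x ![frame3 x a, frame3 x b] *
      volForm o x ![frame3 x a, frame3 x b, v 0] := by
  have hs : ∀ a, ∑ b, β x ![frame3 x a, frame3 x b] * volForm o x ![frame3 x a, frame3 x b, v 0] =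
      ∑ b, β x ![frame3 x a, frame x b] * volForm o x ![frame3 x a, frame x b, v 0] := fun a =>
    (sum_frame x (fun w => β x ![frame3 x a, w] * volForm o x ![frame3 x a, w, v 0])).symm
  simp only [hs]
  rw [← sum_frame x (fun w => ∑ b, β x ![w, frame x b] * volForm o x ![w, frame x b, v 0])]
  simp only [star, ContinuousAlternatingMap.smul_apply, ContinuousAlternatingMap.sum_apply]
  simp_rw [sum_fin_succ_fun]
  simp only [Finset.univ_unique, Finset.sum_singleton, Nat.factorial_two, Nat.cast_two, smul_eq_mul]
  congr 1
  refine Finset.sum_congr rfl fun a _ => Finset.sum_congr rfl fun b _ => ?_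
  congr 1
  · congr 1
    ext i; fin_cases i <;> rfl
  · change volForm o x _ = _
    congr 1
    ext i; fin_cases i <;> rfl

theorem star_three_apply (h : 0 + 3 = 3) (β : Form M 3) (x : M)
    (v : Fin 0 → TangentSpace (𝓡 3) x) :
    star o h β x v = 6⁻¹ * ∑ a, ∑ b, ∑ c, β x ![frame3 x a, frame3 x b, frame3 x c] *
      volForm o x ![frame3 x a, frame3 x b, frame3 x c] := by
  have hs : ∀ a b, ∑ c, β x ![a, b, frame3 x c] * volForm o x ![a, b, frame3 x c] =
      ∑ c, β x ![a, b, frame x c] * volForm o x ![a, b, frame x c] := fun a b =>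
    (sum_frame x (fun w => β x ![a, b, w] * volForm o x ![a, b, w])).symm
  have hs' : ∀ a, ∑ b, ∑ c, β x ![a, frame3 x b, frame x c] * volForm o x ![a, frame3 x b, frame x c] =
      ∑ b, ∑ c, β x ![a, frame x b, frame x c] * volForm o x ![a, frame x b, frame x c] := fun a =>
    (sum_frame x (fun w => ∑ c, β x ![a, w, frame x c] * volForm o x ![a, w, frame x c])).symm
  simp only [hs, hs']
  rw [← sum_frame x (fun w => ∑ b, ∑ c, β x ![w, frame x b, frame x c] *
    volForm o x ![w, frame x b, frame x c])]
  simp only [star, ContinuousAlternatingMap.smul_apply, ContinuousAlternatingMap.sum_apply]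
  simp_rw [sum_fin_succ_fun]
  simp only [Finset.univ_unique, Finset.sum_singleton, smul_eq_mul]
  congr 1
  refine Finset.sum_congr rfl fun a _ => Finset.sum_congr rfl fun b _ =>
    Finset.sum_congr rfl fun c _ => ?_
  congr 1
  · congr 1
    ext i; fin_cases i <;> rfl
  · change volForm o x _ = _
    congr 1
    ext i; fin_cases i <;> rfl

theorem flat_apply (u : VField M) (x : M) (v : Fin 1 → TangentSpace (𝓡 3) x) :
    flat u x v = inner ℝ (u x) (v 0) := rfl

theorem star_flat_apply (h : 2 + 1 = 3) (u : VField M) (x : M)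
    (v : Fin 2 → TangentSpace (𝓡 3) x) :
    star o h (flat u) x v = volForm o x ![u x, v 0, v 1] := by
  rw [star_one_apply]
  simp only [volForm_eq_det3]
  simp [flat_apply, det3, Fin.sum_univ_three, OrthonormalBasis.inner_eq_ite,
    real_inner_comm (u x)]
  ring

/-- Contracting two volume forms over two slots gives ½ ∑ dV(z, e_a, e_b) dV(e_a, e_b, v) = ⟨z, v⟩.
The frame need not be positively oriented, but its sign enters twice and squares to 1. -/
theorem star_interior_apply (h : 1 + 2 = 3) (z : VField M) (β : Form M 2) (x : M)
    (hβ : ∀ v, β x v = volForm o x ![z x, v 0, v 1]) : star o h β x = flat z x := by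
  ext v
  rw [star_two_apply, flat_apply]
  simp only [hβ]
  simp only [volForm_eq_det3]
  have hz : inner ℝ (z x) (v 0) = ∑ i, inner ℝ (frame3 x i) (z x) * inner ℝ (frame3 x i) (v 0) := by
    rw [← (frame3 x).sum_inner_mul_inner (z x) (v 0)]
    simp [real_inner_comm]
  have hc := frameSign_sq o x
  rw [hz]
  simp [det3, Fin.sum_univ_three, OrthonormalBasis.inner_eq_ite]
  linear_combination (inner ℝ (frame3 x 0) (z x) * inner ℝ (frame3 x 0) (v 0) +
    inner ℝ (frame3 x 1) (z x) * inner ℝ (frame3 x 1) (v 0) +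
    inner ℝ (frame3 x 2) (z x) * inner ℝ (frame3 x 2) (v 0)) * hc

theorem star_smul_volForm (h : 0 + 3 = 3) (f : ℝ) (β : Form M 3) (x : M)
    (hβ : β x = f • volForm o x) (v : Fin 0 → TangentSpace (𝓡 3) x) : star o h β x v = f := by
  rw [star_three_apply, hβ]
  simp only [ContinuousAlternatingMap.smul_apply, smul_eq_mul]
  simp only [volForm_eq_det3]
  have hc := frameSign_sq o x
  simp [det3, Fin.sum_univ_three, OrthonormalBasis.inner_eq_ite]
  linear_combination f * hc

/-- The cross product of vector fields, as a one-form. -/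
def crossForm (u w : VField M) : Form M 1 := fun x =>
  ((volForm o x).curryLeft (u x)).curryLeft (w x)

theorem crossForm_apply (u w : VField M) (x : M) (v : Fin 1 → TangentSpace (𝓡 3) x) :
    crossForm o u w x v = volForm o x ![u x, w x, v 0] := by
  change volForm o x _ = _
  congr 1
  ext i; fin_cases i <;> rfl

theorem wedge_one_one_apply {W : Type*} [AddCommGroup W] [Module ℝ W] [TopologicalSpace W]
    (h : 1 + 1 = 2) (α β : W [⋀^Fin 1]→L[ℝ] ℝ) (v : Fin 2 → W) :
    wedge h α β v = α ![v 0] * β ![v 1] - α ![v 1] * β ![v 0] := by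
  have hv : ∀ (f : Fin 1 → W), f = ![f 0] := fun f => by ext i; fin_cases i; rfl
  rw [wedge_apply]
  rw [show (Finset.univ : Finset (Equiv.Perm (Fin 2))) = {1, Equiv.swap 0 1} by decide,
    Finset.sum_pair (by decide)]
  rw [hv (fun i => v ((1 : Equiv.Perm (Fin 2)) _)), hv (fun i => v ((1 : Equiv.Perm (Fin 2)) _)),
    hv (fun i => v (Equiv.swap 0 1 _)), hv (fun i => v (Equiv.swap 0 1 _))]
  simp [Fin.cast, Fin.castAdd, Fin.natAdd, Fin.castLE]
  ring

/-- Both sides are linear in dV, so the sign of the frame occurs once on each side and needs no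
cancellation. -/
theorem star_wedge_flat (h : 1 + 2 = 3) (h' : 1 + 1 = 2) (u w : VField M) :
    star o h (wedgeForm h' (flat u) (flat w)) = crossForm o u w := by
  funext x
  ext v
  rw [star_two_apply, crossForm_apply]
  simp only [wedgeForm, wedge_one_one_apply, flat_apply]
  simp only [volForm_eq_det3]
  simp [det3, Fin.sum_univ_three, OrthonormalBasis.inner_eq_ite,
    real_inner_comm (u x), real_inner_comm (w x)]
  ring

/-- The vector field `z` with `β = dV(z, ⋅, ⋅)`. -/
def axial (β : Form M 2) : VField M := fun x =>
  frameSign o x •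
    (β x ![frame3 x 1, frame3 x 2] • frame3 x 0 + β x ![frame3 x 2, frame3 x 0] • frame3 x 1 +
      β x ![frame3 x 0, frame3 x 1] • frame3 x 2)

theorem alt2_eq {W : Type*} [AddCommGroup W] [Module ℝ W] [TopologicalSpace W]
    (β : W [⋀^Fin 2]→L[ℝ] ℝ) (b : Module.Basis (Fin 3) ℝ W) (v : Fin 2 → W) :
    β v = β ![b 1, b 2] * (b.repr (v 0) 1 * b.repr (v 1) 2 - b.repr (v 0) 2 * b.repr (v 1) 1) +
      β ![b 2, b 0] * (b.repr (v 0) 2 * b.repr (v 1) 0 - b.repr (v 0) 0 * b.repr (v 1) 2) +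
      β ![b 0, b 1] * (b.repr (v 0) 0 * b.repr (v 1) 1 - b.repr (v 0) 1 * b.repr (v 1) 0) := by
  have hv : v = ![∑ i, b.repr (v 0) i • b i, ∑ i, b.repr (v 1) i • b i] := by
    simp only [b.sum_repr]
    ext i; fin_cases i <;> rfl
  have hadd0 : ∀ x y z, β ![x + y, z] = β ![x, z] + β ![y, z] := fun x y z => β.vecCons_add ![z] x y
  have hsmul0 : ∀ (c : ℝ) x z, β ![c • x, z] = c * β ![x, z] := fun c x z => β.vecCons_smul ![z] c x
  have hself : ∀ x, β ![x, x] = 0 := fun x =>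
    β.map_eq_zero_of_eq ![x, x] (i := 0) (j := 1) rfl (by decide)
  have hswap : ∀ x y, β ![x, y] = - β ![y, x] := fun x y => by
    have h := β.map_swap ![y, x] (i := 0) (j := 1) (by decide)
    refine Eq.trans ?_ h
    change β _ = β _
    congr 1
    ext i; fin_cases i <;> rfl
  have hadd1 : ∀ x y z, β ![z, x + y] = β ![z, x] + β ![z, y] := fun x y z => by
    rw [hswap, hadd0, hswap x, hswap y]; ring
  have hsmul1 : ∀ (c : ℝ) x z, β ![z, c • x] = c * β ![z, x] := fun c x z => by
    rw [hswap, hsmul0, hswap x]; ring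
  -- The coordinates are frozen first: `hv` expresses `v` through its own coordinates, and rewriting
  -- with it would otherwise also change the `v` inside `b.repr`.
  generalize b.repr (v 0) = p at *
  generalize b.repr (v 1) = q at *
  rw [hv]
  simp only [Fin.sum_univ_three, hadd0, hadd1, hsmul0, hsmul1, hself]
  rw [hswap (b 1) (b 0), hswap (b 2) (b 1), hswap (b 0) (b 2)]
  ring

theorem volForm_axial (β : Form M 2) (x : M) (v : Fin 2 → TangentSpace (𝓡 3) x) :
    β x v = volForm o x ![axial o β x, v 0, v 1] := by
  rw [alt2_eq (β x) (frame3 x).toBasis, volForm_eq_det3]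
  have hc := frameSign_sq o x
  have hr : ∀ (w : TangentSpace (𝓡 3) x) i, (frame3 x).toBasis.repr w i = inner ℝ (frame3 x i) w :=
    fun w i => by rw [(frame3 x).coe_toBasis_repr_apply, (frame3 x).repr_apply_apply]
  simp only [hr]
  simp [axial, det3, inner_add_right, inner_smul_right]
  generalize β x ![frame3 x 1, frame3 x 2] = b0
  generalize β x ![frame3 x 2, frame3 x 0] = b1
  generalize β x ![frame3 x 0, frame3 x 1] = b2
  linear_combination (-1 : ℝ) * (b0 * (inner ℝ (frame3 x 1) (v 0) * inner ℝ (frame3 x 2) (v 1) -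
    inner ℝ (frame3 x 2) (v 0) * inner ℝ (frame3 x 1) (v 1)) +
    b1 * (inner ℝ (frame3 x 2) (v 0) * inner ℝ (frame3 x 0) (v 1) -
    inner ℝ (frame3 x 0) (v 0) * inner ℝ (frame3 x 2) (v 1)) +
    b2 * (inner ℝ (frame3 x 0) (v 0) * inner ℝ (frame3 x 1) (v 1) -
    inner ℝ (frame3 x 1) (v 0) * inner ℝ (frame3 x 0) (v 1))) * hc

/-- Every 2-form in dimension 3 is an interior product dV(z, ⋅, ⋅), so `star_interior_apply`
computes ⋆ on all 2-forms. Both cases of ⋆⋆ = 1 and the smoothness of ⋆ on 2-forms rest on this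
description. -/
theorem star_two_eq_flat_axial (h : 1 + 2 = 3) (β : Form M 2) :
    star o h β = flat (axial o β) := by
  funext x
  exact star_interior_apply o h _ β x (volForm_axial o β x)

theorem star_star_two (h : 1 + 2 = 3) (h' : 2 + 1 = 3) (β : Form M 2) :
    star o h' (star o h β) = β := by
  funext x
  ext v
  rw [star_two_eq_flat_axial, star_flat_apply, volForm_axial o β x v]

theorem star_star_one (h : 2 + 1 = 3) (h' : 1 + 2 = 3) (α : Form M 1) :
    star o h' (star o h α) = α := by
  funext x
  rw [star_interior_apply o h' (sharp α) _ x, flat_sharp]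
  intro v
  rw [← star_flat_apply o h, flat_sharp]

end

/-! ### Changes of charts, naturality of the exterior derivative, and d² = 0 -/

section

section Charts

variable {M : Type*} [TopologicalSpace M] [ChartedSpace (EuclideanSpace ℝ (Fin 3)) M]

theorem chartRep_apply {k : ℕ} (x₀ : M) (α : Form M k) (y : 𝔼) (v : Fin k → 𝔼) :
    chartRep x₀ α y v = α ((extChartAt (𝓡 3) x₀).symm y)
      (fun i => mfderiv 𝓘(ℝ, 𝔼) (𝓡 3) (extChartAt (𝓡 3) x₀).symm y (v i)) := rfl

theorem minSmoothness_two_le : minSmoothness ℝ 2 ≤ ∞ := by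
  rw [minSmoothness_of_isRCLikeNormedField]
  exact ENat.LEInfty.out

theorem extD_apply {k : ℕ} (α : Form M k) (x : M) (v : Fin (k + 1) → TangentSpace (𝓡 3) x) :
    extD α x v = extDeriv (chartRep x α) (extChartAt (𝓡 3) x x)
      (fun i => mfderiv (𝓡 3) 𝓘(ℝ, 𝔼) (extChartAt (𝓡 3) x) x (v i)) := rfl

/-- Points such as φ⁻¹(φ(p)) and p are only propositionally equal, but all tangent spaces unfold to
ℝ³, so the arguments can be compared there. -/
theorem Form.congr_point {k : ℕ} (α : Form M k) {p p' : M} (h : p' = p)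
    (w' : Fin k → TangentSpace (𝓡 3) p') (w : Fin k → TangentSpace (𝓡 3) p)
    (hw : ∀ i, (w' i : 𝔼) = (w i : 𝔼)) : α p' w' = α p w := by
  subst h
  congr 1
  funext i
  exact hw i

theorem IsSmoothForm.contDiffAt {k : ℕ} {α : Form M k} (hα : IsSmoothForm α) {x₀ : M} {y : 𝔼}
    (hy : y ∈ (extChartAt (𝓡 3) x₀).target) : ContDiffAt ℝ ∞ (chartRep x₀ α) y :=
  (hα x₀).contDiffAt ((isOpen_extChartAt_target x₀).mem_nhds hy)

variable [IsManifold (𝓡 3) ∞ M]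

theorem isManifold_one : IsManifold (𝓡 3) 1 M := IsManifold.of_le (n := ∞) (by exact_mod_cast le_top)

theorem mfderiv_extChartAt_symm_apply {x₀ : M} {y : 𝔼} (hy : y ∈ (extChartAt (𝓡 3) x₀).target)
    (v : 𝔼) :
    mfderiv (𝓡 3) 𝓘(ℝ, 𝔼) (extChartAt (𝓡 3) x₀) ((extChartAt (𝓡 3) x₀).symm y)
      (mfderiv 𝓘(ℝ, 𝔼) (𝓡 3) (extChartAt (𝓡 3) x₀).symm y v) = v := by
  have := isManifold_one (M := M)
  have h := mfderiv_extChartAt_comp_mfderivWithin_extChartAt_symm (I := 𝓡 3) hy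
  rw [ModelWithCorners.range_eq_univ, mfderivWithin_univ] at h
  exact congrArg (fun f : 𝔼 →L[ℝ] 𝔼 => f v) h

theorem mfderiv_symm_mfderiv_apply {x₀ : M} {y : 𝔼} (hy : y ∈ (extChartAt (𝓡 3) x₀).target)
    (w : TangentSpace (𝓡 3) ((extChartAt (𝓡 3) x₀).symm y)) :
    mfderiv 𝓘(ℝ, 𝔼) (𝓡 3) (extChartAt (𝓡 3) x₀).symm y
      (mfderiv (𝓡 3) 𝓘(ℝ, 𝔼) (extChartAt (𝓡 3) x₀) ((extChartAt (𝓡 3) x₀).symm y) w) = w := by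
  have := isManifold_one (M := M)
  have h := mfderivWithin_extChartAt_symm_comp_mfderiv_extChartAt (I := 𝓡 3) hy
  rw [ModelWithCorners.range_eq_univ, mfderivWithin_univ] at h
  exact congrArg (fun f : 𝔼 →L[ℝ] 𝔼 => f w) h

theorem contMDiffAt_extChartAt_symm {x₀ : M} {y : 𝔼} (hy : y ∈ (extChartAt (𝓡 3) x₀).target) :
    ContMDiffAt 𝓘(ℝ, 𝔼) (𝓡 3) ∞ (extChartAt (𝓡 3) x₀).symm y :=
  (contMDiffOn_extChartAt_symm x₀).contMDiffAt ((isOpen_extChartAt_target x₀).mem_nhds hy)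

theorem contDiffAt_transition {x₀ x : M} {y : 𝔼} (hy : y ∈ (extChartAt (𝓡 3) x₀).target)
    (hx : (extChartAt (𝓡 3) x₀).symm y ∈ (extChartAt (𝓡 3) x).source) :
    ContDiffAt ℝ ∞ (extChartAt (𝓡 3) x ∘ (extChartAt (𝓡 3) x₀).symm) y := by
  rw [← contMDiffAt_iff_contDiffAt]
  refine ContMDiffAt.comp y (contMDiffAt_extChartAt' ?_) (contMDiffAt_extChartAt_symm hy)
  rwa [extChartAt_source] at hx

theorem fderiv_transition {x₀ x : M} {y : 𝔼} (hy : y ∈ (extChartAt (𝓡 3) x₀).target)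
    (hx : (extChartAt (𝓡 3) x₀).symm y ∈ (extChartAt (𝓡 3) x).source) (v : 𝔼) :
    fderiv ℝ (extChartAt (𝓡 3) x ∘ (extChartAt (𝓡 3) x₀).symm) y v =
      mfderiv (𝓡 3) 𝓘(ℝ, 𝔼) (extChartAt (𝓡 3) x) ((extChartAt (𝓡 3) x₀).symm y)
        (mfderiv 𝓘(ℝ, 𝔼) (𝓡 3) (extChartAt (𝓡 3) x₀).symm y v) := by
  have := isManifold_one (M := M)
  rw [← mfderiv_eq_fderiv, mfderiv_comp y (I' := 𝓡 3)]
  · rfl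
  · exact mdifferentiableAt_extChartAt (by rwa [extChartAt_source] at hx)
  · exact (contMDiffAt_extChartAt_symm hy).mdifferentiableAt (by simp)

theorem chartRep_transition {k : ℕ} (α : Form M k) {x₀ x : M} {y : 𝔼}
    (hy : y ∈ (extChartAt (𝓡 3) x₀).target)
    (hx : (extChartAt (𝓡 3) x₀).symm y ∈ (extChartAt (𝓡 3) x).source) :
    chartRep x₀ α y =
      (chartRep x α ((extChartAt (𝓡 3) x ∘ (extChartAt (𝓡 3) x₀).symm) y)).compContinuousLinearMap
        (fderiv ℝ (extChartAt (𝓡 3) x ∘ (extChartAt (𝓡 3) x₀).symm) y) := by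
  ext v
  rw [ContinuousAlternatingMap.compContinuousLinearMap_apply, chartRep_apply, chartRep_apply]
  have hp : (extChartAt (𝓡 3) x).symm ((extChartAt (𝓡 3) x ∘ (extChartAt (𝓡 3) x₀).symm) y) =
      (extChartAt (𝓡 3) x₀).symm y := (extChartAt (𝓡 3) x).left_inv hx
  refine (Form.congr_point α hp _ _ fun i => ?_).symm
  have hy' : (extChartAt (𝓡 3) x ∘ (extChartAt (𝓡 3) x₀).symm) y ∈ (extChartAt (𝓡 3) x).target :=
    (extChartAt (𝓡 3) x).map_source hx
  have h1 := mfderiv_comp (I := 𝓘(ℝ, 𝔼)) (I' := 𝓘(ℝ, 𝔼)) (I'' := 𝓡 3) y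
    ((contMDiffAt_extChartAt_symm hy').mdifferentiableAt (by simp))
    ((contDiffAt_transition hy hx).differentiableAt (by simp)).mdifferentiableAt
  -- Near y, the transition map followed by the inverse chart at x is the inverse chart at x₀;
  -- equality of germs gives equality of derivatives.
  have h2 : (extChartAt (𝓡 3) x).symm ∘ (extChartAt (𝓡 3) x ∘ (extChartAt (𝓡 3) x₀).symm)
      =ᶠ[nhds y] (extChartAt (𝓡 3) x₀).symm := by
    have h3 := (contMDiffAt_extChartAt_symm hy).continuousAt.preimage_mem_nhds
      ((isOpen_extChartAt_source x).mem_nhds hx)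
    filter_upwards [h3] with z hz
    exact (extChartAt (𝓡 3) x).left_inv hz
  have h4 := h2.mfderiv_eq (I := 𝓘(ℝ, 𝔼)) (I' := 𝓡 3)
  have h5 := congrArg (fun f : 𝔼 →L[ℝ] 𝔼 => f (v i)) (h1.symm.trans h4)
  rw [mfderiv_eq_fderiv] at h5
  exact h5

/-- At a point p, `extD` is computed in the chart preferred at p, so in a fixed chart at x₀ it
refers to a different chart for each y. The exterior derivative on ℝ³ commutes with pullback by the
transition map, which removes this dependence. -/
theorem chartRep_extD {k : ℕ} {α : Form M k} (hα : IsSmoothForm α) {x₀ : M} {y : 𝔼}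
    (hy : y ∈ (extChartAt (𝓡 3) x₀).target) :
    chartRep x₀ (extD α) y = extDeriv (chartRep x₀ α) y := by
  set x := (extChartAt (𝓡 3) x₀).symm y with hxdef
  have hx : (extChartAt (𝓡 3) x₀).symm y ∈ (extChartAt (𝓡 3) x).source := mem_extChartAt_source x
  have hev : chartRep x₀ α =ᶠ[nhds y] fun z =>
      (chartRep x α ((extChartAt (𝓡 3) x ∘ (extChartAt (𝓡 3) x₀).symm) z)).compContinuousLinearMap
        (fderiv ℝ (extChartAt (𝓡 3) x ∘ (extChartAt (𝓡 3) x₀).symm) z) := by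
    filter_upwards [(isOpen_extChartAt_target x₀).mem_nhds hy,
      (contMDiffAt_extChartAt_symm hy).continuousAt.preimage_mem_nhds
        ((isOpen_extChartAt_source x).mem_nhds hx)] with z hz hz'
    exact chartRep_transition α hz hz'
  rw [hev.extDeriv_eq, extDeriv_pullback (r := ∞)]
  · ext v
    rw [chartRep_apply, ContinuousAlternatingMap.compContinuousLinearMap_apply, extD_apply]
    congr 1
    funext i
    exact (fderiv_transition hy hx (v i)).symm
  · exact (hα.contDiffAt ((extChartAt (𝓡 3) x).map_source hx)).differentiableAt (by simp)
  · exact contDiffAt_transition hy hx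
  · exact minSmoothness_two_le

theorem extD_extD {k : ℕ} {α : Form M k} (hα : IsSmoothForm α) : extD (extD α) = 0 := by
  funext x
  have hy := mem_extChartAt_target (I := 𝓡 3) x
  have hev : chartRep x (extD α) =ᶠ[nhds (extChartAt (𝓡 3) x x)] extDeriv (chartRep x α) := by
    filter_upwards [(isOpen_extChartAt_target x).mem_nhds hy] with z hz
    exact chartRep_extD hα hz
  rw [extD, hev.extDeriv_eq, extDeriv_extDeriv_apply (hα.contDiffAt hy)]
  · ext v; rfl
  · exact minSmoothness_two_le

end Charts

end

/-! ### Smoothness of forms, vector fields and the metric in charts -/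

section

section FormSmooth

/-- The standard basis of `ℝ³`. -/
def stdVec (i : Fin 3) : 𝔼 := EuclideanSpace.basisFun (Fin 3) ℝ i

theorem stdVec_apply (i j : Fin 3) : stdVec i j = if j = i then 1 else 0 := by
  simp [stdVec]

theorem sum_smul_stdVec (v : 𝔼) : ∑ i, v i • stdVec i = v := by
  simpa [stdVec] using (EuclideanSpace.basisFun (Fin 3) ℝ).sum_repr v

/-- Evaluation of forms on the vectors of the standard basis. -/
def evalStd (k : ℕ) : (𝔼 [⋀^Fin k]→L[ℝ] ℝ) →ₗ[ℝ] ((Fin k → Fin 3) → ℝ) where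
  toFun α J := α (fun i => stdVec (J i))
  map_add' _ _ := rfl
  map_smul' _ _ := rfl

theorem evalStd_injective (k : ℕ) : Function.Injective (evalStd k) := by
  intro α β h
  have h2 : α.toMultilinearMap = β.toMultilinearMap := by
    refine Module.Basis.ext_multilinear (fun _ => (EuclideanSpace.basisFun (Fin 3) ℝ).toBasis)
      fun J => ?_
    simpa [evalStd, stdVec] using congrFun h J
  ext v
  exact congrArg (fun f => f v) h2

/-- Forms on ℝ³ are determined by their finitely many values on basis vectors. A linear left inverse
of `evalStd` recovers the form smoothly from these values. -/
theorem contDiffOn_form_iff {D : Type*} [NormedAddCommGroup D] [NormedSpace ℝ D] {k : ℕ}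
    {f : D → 𝔼 [⋀^Fin k]→L[ℝ] ℝ} {s : Set D} {n : ℕ∞ω} :
    ContDiffOn ℝ n f s ↔ ∀ v, ContDiffOn ℝ n (fun p => f p v) s := by
  refine ⟨fun h v => ?_, fun h => ?_⟩
  · exact (ContinuousAlternatingMap.apply ℝ 𝔼 ℝ v).contDiff.comp_contDiffOn h
  · obtain ⟨L, hL⟩ := LinearMap.exists_leftInverse_of_injective (evalStd k)
      (LinearMap.ker_eq_bot.2 (evalStd_injective k))
    have h2 : ContDiffOn ℝ n (fun p => evalStd k (f p)) s := contDiffOn_pi.2 fun J => h _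
    have h3 := L.toContinuousLinearMap.contDiff.comp_contDiffOn h2
    refine h3.congr fun p _ => ?_
    exact (congrArg (fun g => g (f p)) hL).symm

end FormSmooth

section VectorFields

variable {M : Type*} [TopologicalSpace M] [ChartedSpace (EuclideanSpace ℝ (Fin 3)) M]
variable [IsManifold (𝓡 3) ∞ M]

/-- The trivialization of the tangent bundle at x₀ is the derivative of the chart. This turns
smoothness of sections into smoothness of `vfieldRep`. -/
theorem trivializationAt_apply_snd {x₀ p : M} (hp : p ∈ (extChartAt (𝓡 3) x₀).source)
    (v : TangentSpace (𝓡 3) p) :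
    (trivializationAt 𝔼 (TangentSpace (𝓡 3)) x₀ ⟨p, v⟩).2 =
      mfderiv (𝓡 3) 𝓘(ℝ, 𝔼) (extChartAt (𝓡 3) x₀) p v := by
  have := isManifold_one (M := M)
  rw [extChartAt_source] at hp
  refine Eq.trans ?_ (congrArg (fun f : 𝔼 →L[ℝ] 𝔼 => f v)
    (TangentBundle.continuousLinearMapAt_trivializationAt (I := 𝓡 3) hp))
  exact (congrFun ((trivializationAt 𝔼 (TangentSpace (𝓡 3)) x₀).coe_linearMapAt_of_mem (R := ℝ) hp) v).symm

/-- A time-dependent vector field is smooth if and only if its expressions in charts are. -/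
theorem smoothVField_interval_iff {J : Set ℝ} {u : ℝ → VField M} :
    (TimeDomain.interval J).SmoothVField u ↔ ∀ x₀ : M,
      ContDiffOn ℝ ∞ (fun p : ℝ × 𝔼 => vfieldRep x₀ (u p.1) p.2)
        (J ×ˢ (extChartAt (𝓡 3) x₀).target) := by
  constructor
  · intro h x₀ q hq
    have hs : ContMDiffAt 𝓘(ℝ, ℝ × 𝔼) (𝓘(ℝ, ℝ).prod (𝓡 3)) ∞
        (fun q : ℝ × 𝔼 => (q.1, (extChartAt (𝓡 3) x₀).symm q.2)) q :=
      contDiff_fst.contMDiff.contMDiffAt.prodMk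
        ((contMDiffAt_extChartAt_symm hq.2).comp q contDiff_snd.contMDiff.contMDiffAt)
    have h1 := ContMDiffWithinAt.comp (t := J ×ˢ Set.univ) q
      (h (q.1, (extChartAt (𝓡 3) x₀).symm q.2) ⟨hq.1, trivial⟩)
      (hs.contMDiffWithinAt (s := J ×ˢ (extChartAt (𝓡 3) x₀).target))
      (fun z hz => Set.mk_mem_prod hz.1 trivial)
    rw [(trivializationAt 𝔼 (TangentSpace (𝓡 3)) x₀).contMDiffWithinAt_iff] at h1
    · refine contMDiffWithinAt_iff_contDiffWithinAt.1 (h1.2.congr (fun z hz => ?_) ?_)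
      · exact (trivializationAt_apply_snd ((extChartAt (𝓡 3) x₀).map_target hz.2) _).symm
      · exact (trivializationAt_apply_snd ((extChartAt (𝓡 3) x₀).map_target hq.2) _).symm
    · have := (extChartAt (𝓡 3) x₀).map_target hq.2
      rw [extChartAt_source] at this
      simpa [Bundle.Trivialization.mem_source] using this
  · intro h q hq
    have hq' := mem_extChartAt_source (I := 𝓡 3) q.2
    rw [(trivializationAt 𝔼 (TangentSpace (𝓡 3)) q.2).contMDiffWithinAt_iff]
    · refine ⟨contMDiff_snd.contMDiffAt.contMDiffWithinAt, ?_⟩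
      have h1 := (h q.2 (q.1, extChartAt (𝓡 3) q.2 q.2)
        ⟨hq.1, mem_extChartAt_target q.2⟩).contMDiffWithinAt
      have hs : ContMDiffAt (𝓘(ℝ, ℝ).prod (𝓡 3)) 𝓘(ℝ, ℝ × 𝔼) ∞
          (fun z : ℝ × M => (z.1, extChartAt (𝓡 3) q.2 z.2)) q := by
        refine contMDiff_fst.contMDiffAt.prodMk_space ?_
        exact (contMDiffAt_extChartAt (x := q.2)).comp q contMDiff_snd.contMDiffAt
      have hn : ∀ᶠ z in nhds q, z.2 ∈ (extChartAt (𝓡 3) q.2).source :=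
        continuous_snd.continuousAt.eventually ((isOpen_extChartAt_source q.2).mem_nhds hq')
      have h2 := ContMDiffWithinAt.comp (t := J ×ˢ (extChartAt (𝓡 3) q.2).target) q h1
        (hs.contMDiffWithinAt (s := J ×ˢ (extChartAt (𝓡 3) q.2).source))
        (fun z hz => ⟨hz.1, (extChartAt (𝓡 3) q.2).map_source hz.2⟩)
      have h3 : ∀ z : ℝ × M, z.2 ∈ (extChartAt (𝓡 3) q.2).source →
          (trivializationAt 𝔼 (TangentSpace (𝓡 3)) q.2 ⟨z.2, u z.1 z.2⟩).2 =
            vfieldRep q.2 (u z.1) (extChartAt (𝓡 3) q.2 z.2) := fun z hz => by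
        rw [trivializationAt_apply_snd hz]
        simp only [vfieldRep]
        rw [(extChartAt (𝓡 3) q.2).left_inv hz]
      -- So far smoothness is known on J times the chart source, which is a neighbourhood of q
      -- within J times the whole manifold.
      refine (h2.congr (fun z hz => h3 z hz.2) (h3 q hq')).mono_of_mem_nhdsWithin ?_
      filter_upwards [hn.filter_mono nhdsWithin_le_nhds, self_mem_nhdsWithin] with z hz hz'
      exact ⟨hz'.1, hz⟩
    · simp

variable [Bundle.RiemannianBundle (fun x : M => TangentSpace (𝓡 3) x)]
    [IsContMDiffRiemannianBundle (𝓡 3) ∞ (EuclideanSpace ℝ (Fin 3))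
      (fun x : M => TangentSpace (𝓡 3) x)]

/-- The coordinate fields are smooth sections, since the trivialization makes them constant, and the
Riemannian bundle structure makes inner products of smooth sections smooth. -/
theorem contDiffOn_metricRep (x₀ : M) (v w : 𝔼) :
    ContDiffOn ℝ ∞ (metricRep x₀ v w) (extChartAt (𝓡 3) x₀).target := by
  have hsec : ∀ v : 𝔼, ContMDiffOn 𝓘(ℝ, 𝔼) (𝓡 3).tangent ∞
      (fun y => (⟨(extChartAt (𝓡 3) x₀).symm y,
        mfderiv 𝓘(ℝ, 𝔼) (𝓡 3) (extChartAt (𝓡 3) x₀).symm y v⟩ : TangentBundle (𝓡 3) M))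
      (extChartAt (𝓡 3) x₀).target := by
    intro v y hy
    rw [(trivializationAt 𝔼 (TangentSpace (𝓡 3)) x₀).contMDiffWithinAt_iff]
    · refine ⟨(contMDiffAt_extChartAt_symm hy).contMDiffWithinAt, ?_⟩
      refine (contMDiffWithinAt_const (c := v)).congr (fun z hz => ?_) ?_
      · rw [trivializationAt_apply_snd ((extChartAt (𝓡 3) x₀).map_target hz),
          mfderiv_extChartAt_symm_apply hz]
      · rw [trivializationAt_apply_snd ((extChartAt (𝓡 3) x₀).map_target hy),
          mfderiv_extChartAt_symm_apply hy]
    · have := (extChartAt (𝓡 3) x₀).map_target hy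
      rw [extChartAt_source] at this
      simpa [Bundle.Trivialization.mem_source] using this
  exact ((hsec v).inner_bundle (hsec w)).contDiffOn

end VectorFields

end

/-! ### Joint smoothness in time and space; the musical isomorphisms in charts -/

section

variable {M : Type*} [TopologicalSpace M] [ChartedSpace (EuclideanSpace ℝ (Fin 3)) M]

section Ops

/-- The derivative in space of a jointly smooth function. -/
theorem contDiffOn_fderiv_snd {F : Type*} [NormedAddCommGroup F] [NormedSpace ℝ F] {J : Set ℝ}
    (hJ : UniqueDiffOn ℝ J) {U : Set 𝔼} (hU : IsOpen U) {f : ℝ → 𝔼 → F}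
    (hf : ContDiffOn ℝ ∞ (fun p : ℝ × 𝔼 => f p.1 p.2) (J ×ˢ U)) :
    ContDiffOn ℝ ∞ (fun p : ℝ × 𝔼 => fderiv ℝ (f p.1) p.2) (J ×ˢ U) := by
  have h1 : ContDiffOn ℝ ∞ (fderivWithin ℝ (fun p : ℝ × 𝔼 => f p.1 p.2) (J ×ˢ U)) (J ×ˢ U) :=
    hf.fderivWithin (hJ.prod hU.uniqueDiffOn) (by simp)
  -- The spatial derivative is the total derivative within J × U restricted to the second factor.
  -- Since U is open, "within" may be dropped in space, while in time unique differentiability of J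
  -- suffices.
  have h2 : ContDiffOn ℝ ∞ (fun p => (fderivWithin ℝ (fun p : ℝ × 𝔼 => f p.1 p.2) (J ×ˢ U) p).comp
      (ContinuousLinearMap.inr ℝ ℝ 𝔼)) (J ×ˢ U) := h1.clm_comp contDiffOn_const
  refine h2.congr fun p hp => ?_
  have h3 := (hf.differentiableOn (by simp) p hp).hasFDerivWithinAt
  have h4 : HasFDerivWithinAt (fun y : 𝔼 => (p.1, y)) (ContinuousLinearMap.inr ℝ ℝ 𝔼) U p.2 :=
    (hasFDerivAt_prodMk_right p.1 p.2).hasFDerivWithinAt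
  have h5 := HasFDerivWithinAt.comp (t := J ×ˢ U) p.2 h3 h4
    (fun y hy => Set.mk_mem_prod hp.1 hy)
  exact (h5.hasFDerivAt (hU.mem_nhds hp.2)).fderiv

/-- Joint smoothness in `t ∈ J` and in space of a time-dependent form. -/
def JointForm {k : ℕ} (J : Set ℝ) (a : ℝ → Form M k) : Prop :=
  ∀ (x₀ : M) (v : Fin k → 𝔼), ContDiffOn ℝ ∞ (fun p : ℝ × 𝔼 => chartRep x₀ (a p.1) p.2 v)
    (J ×ˢ (extChartAt (𝓡 3) x₀).target)

/-- Joint smoothness in `t ∈ J` and in space of a time-dependent vector field. -/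
def JointVField (J : Set ℝ) (u : ℝ → VField M) : Prop :=
  ∀ x₀ : M, ContDiffOn ℝ ∞ (fun p : ℝ × 𝔼 => vfieldRep x₀ (u p.1) p.2)
    (J ×ˢ (extChartAt (𝓡 3) x₀).target)

theorem jointForm_iff {J : Set ℝ} {k : ℕ} {a : ℝ → Form M k} :
    JointForm J a ↔ (TimeDomain.interval J).SmoothForm a :=
  forall_congr' fun _ => contDiffOn_form_iff.symm

theorem JointForm.isSmoothForm {J : Set ℝ} {k : ℕ} {a : ℝ → Form M k} (ha : JointForm J a) {t : ℝ}
    (ht : t ∈ J) : IsSmoothForm (a t) :=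
  fun x₀ => contDiffOn_form_iff.2 fun v => (ha x₀ v).comp
    (contDiff_const.prodMk contDiff_id).contDiffOn (fun _ hy => Set.mk_mem_prod ht hy)

theorem IsSmoothForm.jointForm {J : Set ℝ} {k : ℕ} {α : Form M k} (hα : IsSmoothForm α) :
    JointForm J (fun _ => α) :=
  fun x₀ v => (contDiffOn_form_iff.1 (hα x₀) v).comp contDiff_snd.contDiffOn (fun _ hp => hp.2)

theorem jointForm_wedge {J : Set ℝ} {p q k : ℕ} (h : p + q = k) {a : ℝ → Form M p}
    {b : ℝ → Form M q} (ha : JointForm J a)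
    (hb : JointForm J b) :
    JointForm J (fun t => wedgeForm h (a t) (b t)) := by
  intro x₀ v
  have he : ∀ z : ℝ × 𝔼, chartRep x₀ (wedgeForm h (a z.1) (b z.1)) z.2 v =
      ((p.factorial : ℝ) * (q.factorial : ℝ))⁻¹ * ∑ σ : Equiv.Perm (Fin k), Equiv.Perm.sign σ •
        (chartRep x₀ (a z.1) z.2 (fun i => v (σ (Fin.cast h (Fin.castAdd q i)))) *
          chartRep x₀ (b z.1) z.2 (fun i => v (σ (Fin.cast h (Fin.natAdd p i))))) := fun z => by
    rw [chartRep_apply]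
    exact wedge_apply h _ _ _
  simp only [he]
  refine contDiffOn_const.mul (ContDiffOn.sum fun σ _ => ContDiffOn.const_smul _ ?_)
  exact (ha x₀ _).mul (hb x₀ _)

theorem jointForm_sum {J : Set ℝ} {k : ℕ} {ι : Type*} (s : Finset ι) {a : ι → ℝ → Form M k}
    (ha : ∀ i ∈ s, JointForm J (a i)) :
    JointForm J (fun t => ∑ i ∈ s, a i t) := by
  intro x₀ v
  have he : ∀ z : ℝ × 𝔼, chartRep x₀ (∑ i ∈ s, a i z.1) z.2 v =
      ∑ i ∈ s, chartRep x₀ (a i z.1) z.2 v := fun z => by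
    simp only [chartRep_apply, Finset.sum_apply, ContinuousAlternatingMap.sum_apply]
  simp only [he]
  exact ContDiffOn.sum fun i hi => ha i hi x₀ v

theorem jointForm_smul {J : Set ℝ} {k : ℕ} (c : ℝ) {a : ℝ → Form M k}
    (ha : JointForm J a) :
    JointForm J (fun t => c • a t) :=
  fun x₀ v => contDiffOn_const.mul (ha x₀ v)

variable [IsManifold (𝓡 3) ∞ M]

theorem jointForm_extD {J : Set ℝ} (hJ : UniqueDiffOn ℝ J) {k : ℕ} {a : ℝ → Form M k}
    (ha : JointForm J a) :
    JointForm J (fun t => extD (a t)) := by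
  intro x₀
  rw [← contDiffOn_form_iff]
  have h1 := contDiffOn_fderiv_snd hJ (isOpen_extChartAt_target (I := 𝓡 3) x₀)
    (f := fun t => chartRep x₀ (a t)) (contDiffOn_form_iff.2 (ha x₀))
  -- `extDeriv` is this continuous linear map applied to the spatial derivative.
  have h2 := (ContinuousAlternatingMap.alternatizeUncurryFinCLM ℝ 𝔼 ℝ (n := k)).contDiff.comp_contDiffOn
    h1
  exact h2.congr fun p hp => chartRep_extD (ha.isSmoothForm hp.1) hp.2

end Ops

section Metric

variable [Bundle.RiemannianBundle (fun x : M => TangentSpace (𝓡 3) x)]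

theorem metricRep_sum_left (x₀ : M) (v w y : 𝔼) :
    metricRep x₀ v w y = ∑ i, v i * metricRep x₀ (stdVec i) w y := by
  conv_lhs => rw [← sum_smul_stdVec v]
  let A : 𝔼 →L[ℝ] TangentSpace (𝓡 3) ((extChartAt (𝓡 3) x₀).symm y) :=
    mfderiv 𝓘(ℝ, 𝔼) (𝓡 3) (extChartAt (𝓡 3) x₀).symm y
  change inner ℝ (A _) (A w) = ∑ i, v i * inner ℝ (A _) (A w)
  simp only [map_sum, map_smul, sum_inner, real_inner_smul_left]

theorem metricRep_comm (x₀ : M) (v w y : 𝔼) : metricRep x₀ v w y = metricRep x₀ w v y :=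
  real_inner_comm _ _

/-- The matrix of the metric in a chart, as a linear map. -/
def metricMap (x₀ : M) (y : 𝔼) : 𝔼 →L[ℝ] 𝔼 :=
  ∑ i, ∑ j, metricRep x₀ (stdVec i) (stdVec j) y •
    (EuclideanSpace.proj i : 𝔼 →L[ℝ] ℝ).smulRight (stdVec j)

theorem metricMap_apply (x₀ : M) (y v : 𝔼) (j : Fin 3) :
    metricMap x₀ y v j = metricRep x₀ v (stdVec j) y := by
  rw [metricRep_sum_left]
  simp [metricMap, stdVec_apply, Finset.sum_apply]
  exact Finset.sum_congr rfl fun i _ => mul_comm _ _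

variable [IsManifold (𝓡 3) ∞ M]

theorem metricRep_self_ne_zero {x₀ : M} {y v : 𝔼} (hy : y ∈ (extChartAt (𝓡 3) x₀).target)
    (h : metricRep x₀ v v y = 0) : v = 0 := by
  have h1 := inner_self_eq_zero.1 h
  rw [← mfderiv_extChartAt_symm_apply hy v, h1]
  exact map_zero _

theorem chartRep_flat {x₀ : M} {y : 𝔼} (hy : y ∈ (extChartAt (𝓡 3) x₀).target) (u : VField M)
    (v : Fin 1 → 𝔼) : chartRep x₀ (flat u) y v = metricRep x₀ (vfieldRep x₀ u y) (v 0) y := by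
  rw [chartRep_apply, flat_apply, metricRep, vfieldRep, mfderiv_symm_mfderiv_apply hy]

/-- Positive definiteness: if v is in the kernel, then g(v, v) = ∑ vᵢ g(v, ∂ᵢ) = 0, so v = 0, and an
injective endomorphism of ℝ³ is invertible. -/
theorem metricMap_isInvertible {x₀ : M} {y : 𝔼} (hy : y ∈ (extChartAt (𝓡 3) x₀).target) :
    (metricMap x₀ y).IsInvertible := by
  have hinj : Function.Injective (metricMap x₀ y).toLinearMap := by
    rw [injective_iff_map_eq_zero]
    intro v hv
    refine metricRep_self_ne_zero hy ?_
    rw [metricRep_comm, metricRep_sum_left]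
    refine Finset.sum_eq_zero fun i _ => ?_
    have h1 : metricMap x₀ y v i = 0 := by
      rw [show metricMap x₀ y v = 0 from hv]; rfl
    rw [metricRep_comm, ← metricMap_apply, h1, mul_zero]
  exact ⟨(LinearEquiv.ofInjectiveEndo _ hinj).toContinuousLinearEquiv, by ext; rfl⟩

variable [IsContMDiffRiemannianBundle (𝓡 3) ∞ (EuclideanSpace ℝ (Fin 3))
      (fun x : M => TangentSpace (𝓡 3) x)]

theorem contDiffOn_metricMap (x₀ : M) :
    ContDiffOn ℝ ∞ (metricMap x₀) (extChartAt (𝓡 3) x₀).target := by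
  have h : ContDiffOn ℝ ∞ (fun y => ∑ i, ∑ j, metricRep x₀ (stdVec i) (stdVec j) y •
    (EuclideanSpace.proj i : 𝔼 →L[ℝ] ℝ).smulRight (stdVec j)) (extChartAt (𝓡 3) x₀).target :=
    ContDiffOn.sum fun i _ => ContDiffOn.sum fun j _ =>
      (contDiffOn_metricRep x₀ _ _).smul contDiffOn_const
  exact h

theorem jointForm_flat {J : Set ℝ} {u : ℝ → VField M}
    (hu : JointVField J u) :
    JointForm J (fun t => flat (u t)) := by
  intro x₀ v
  have he : ContDiffOn ℝ ∞ (fun z : ℝ × 𝔼 => ∑ i, vfieldRep x₀ (u z.1) z.2 i *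
      metricRep x₀ (stdVec i) (v 0) z.2) (J ×ˢ (extChartAt (𝓡 3) x₀).target) :=
    ContDiffOn.sum fun i _ => ((EuclideanSpace.proj i : 𝔼 →L[ℝ] ℝ).contDiff.comp_contDiffOn
      (hu x₀)).mul ((contDiffOn_metricRep x₀ _ _).comp contDiff_snd.contDiffOn fun _ hp => hp.2)
  refine he.congr fun z hz => ?_
  rw [chartRep_flat hz.2, metricRep_sum_left]

/-- The frames in the definition of `sharp` carry no regularity. In a chart, however, α^♯ is the
inverse metric matrix applied to the coefficients of α, and inversion is smooth at invertible maps.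
-/
theorem jointVField_sharp {J : Set ℝ} {a : ℝ → Form M 1}
    (ha : JointForm J a) :
    JointVField J (fun t => sharp (a t)) := by
  intro x₀
  have h1 : ContDiffOn ℝ ∞ (fun z : ℝ × 𝔼 => ((metricMap x₀ z.2).inverse
      (∑ j, chartRep x₀ (a z.1) z.2 (fun _ => stdVec j) • stdVec j)))
      (J ×ˢ (extChartAt (𝓡 3) x₀).target) := by
    refine ContDiffOn.clm_apply ?_ (ContDiffOn.sum fun j _ => (ha x₀ _).smul contDiffOn_const)
    intro z hz
    exact ((metricMap_isInvertible hz.2).contDiffAt_map_inverse).comp_contDiffWithinAt z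
      (((contDiffOn_metricMap x₀).comp contDiff_snd.contDiffOn fun _ hp => hp.2) z hz)
  refine h1.congr fun z hz => ?_
  have h2 : ∑ j, chartRep x₀ (a z.1) z.2 (fun _ => stdVec j) • stdVec j =
      metricMap x₀ z.2 (vfieldRep x₀ (sharp (a z.1)) z.2) := by
    ext i
    rw [metricMap_apply]
    have h3 := chartRep_flat hz.2 (sharp (a z.1)) (fun _ => stdVec i)
    rw [flat_sharp] at h3
    simp [stdVec_apply, h3]
  rw [h2]
  obtain ⟨e, he⟩ := metricMap_isInvertible hz.2
  rw [← he, ContinuousLinearMap.inverse_equiv]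
  simp

end Metric

end

/-! ### The volume density and smoothness of the Hodge star -/

section

variable {M : Type*} [TopologicalSpace M] [ChartedSpace (EuclideanSpace ℝ (Fin 3)) M]
  [Bundle.RiemannianBundle (fun x : M => TangentSpace (𝓡 3) x)]
  (o : ∀ x : M, Orientation ℝ (TangentSpace (𝓡 3) x) (Fin 3))

/-- The density of the volume form in a chart. -/
def density (x₀ : M) (y : 𝔼) : ℝ :=
  chartRep x₀ (volForm o) y ![stdVec 0, stdVec 1, stdVec 2]

theorem chartRep_volForm (x₀ : M) (y a b c : 𝔼) :
    chartRep x₀ (volForm o) y ![a, b, c] = density o x₀ y * det3 a b c := by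
  have h := alt3_eq_det3 (chartRep x₀ (volForm o) y) (EuclideanSpace.basisFun (Fin 3) ℝ).toBasis
    ![a, b, c]
  have hr : ∀ w : 𝔼, ((EuclideanSpace.basisFun (Fin 3) ℝ).toBasis.repr w : Fin 3 → ℝ) = w :=
    fun w => rfl
  simp only [hr, OrthonormalBasis.coe_toBasis] at h
  exact h

theorem volForm_chart (x₀ : M) (y a b c : 𝔼) :
    volForm o ((extChartAt (𝓡 3) x₀).symm y)
      ![mfderiv 𝓘(ℝ, 𝔼) (𝓡 3) (extChartAt (𝓡 3) x₀).symm y a,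
        mfderiv 𝓘(ℝ, 𝔼) (𝓡 3) (extChartAt (𝓡 3) x₀).symm y b,
        mfderiv 𝓘(ℝ, 𝔼) (𝓡 3) (extChartAt (𝓡 3) x₀).symm y c] = density o x₀ y * det3 a b c := by
  rw [← chartRep_volForm, chartRep_apply]
  congr 1
  ext i; fin_cases i <;> rfl

theorem contDiffOn_density {o : ∀ x : M, Orientation ℝ (TangentSpace (𝓡 3) x) (Fin 3)}
    (ho : IsSmoothForm (volForm o)) (x₀ : M) :
    ContDiffOn ℝ ∞ (density o x₀) (extChartAt (𝓡 3) x₀).target :=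
  contDiffOn_form_iff.1 (ho x₀) _

theorem contDiffOn_density_prod {o : ∀ x : M, Orientation ℝ (TangentSpace (𝓡 3) x) (Fin 3)}
    (ho : IsSmoothForm (volForm o)) {J : Set ℝ} (x₀ : M) :
    ContDiffOn ℝ ∞ (fun p : ℝ × 𝔼 => density o x₀ p.2)
    (J ×ˢ (extChartAt (𝓡 3) x₀).target) :=
  (contDiffOn_density ho x₀).comp contDiff_snd.contDiffOn fun _ hp => hp.2

theorem frameSign_ne_zero (x : M) : frameSign o x ≠ 0 := fun h => by
  have := frameSign_sq o x
  simp [h] at this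

theorem codiff_one (α : Form M 1) :
    codiff o α = star o (rfl : 0 + 3 = 3) (extD (star o (rfl : 2 + 1 = 3) α)) := by
  rw [codiff, dif_pos (by norm_num)]
  norm_num

theorem codiff_two (α : Form M 2) :
    codiff o α = -star o (rfl : 1 + 2 = 3) (extD (star o (rfl : 1 + 2 = 3) α)) := by
  rw [codiff, dif_pos (by norm_num)]
  norm_num
  exact neg_one_smul ℝ (star o (rfl : 1 + 2 = 3) (extD (star o (rfl : 1 + 2 = 3) α)))

theorem codiff_three (α : Form M 3) :
    codiff o α = star o (rfl : 2 + 1 = 3) (extD (star o (rfl : 0 + 3 = 3) α)) := by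
  rw [codiff, dif_pos (by norm_num)]
  norm_num

variable [IsManifold (𝓡 3) ∞ M]

theorem density_ne_zero {x₀ : M} {y : 𝔼} (hy : y ∈ (extChartAt (𝓡 3) x₀).target) :
    density o x₀ y ≠ 0 := by
  intro h
  apply frameSign_ne_zero o ((extChartAt (𝓡 3) x₀).symm y)
  -- The frame vectors are written in coordinates: their volume is nonzero, and it is the density
  -- times a determinant.
  obtain ⟨c, hc⟩ : ∃ c : Fin 3 → 𝔼, ∀ i, mfderiv 𝓘(ℝ, 𝔼) (𝓡 3) (extChartAt (𝓡 3) x₀).symm y (c i) =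
      frame3 ((extChartAt (𝓡 3) x₀).symm y) i :=
    ⟨fun i => mfderiv (𝓡 3) 𝓘(ℝ, 𝔼) (extChartAt (𝓡 3) x₀) ((extChartAt (𝓡 3) x₀).symm y)
      (frame3 ((extChartAt (𝓡 3) x₀).symm y) i), fun i => mfderiv_symm_mfderiv_apply hy _⟩
  rw [frameSign, ← hc, ← hc, ← hc, volForm_chart, h, zero_mul]

theorem chartRep_star_flat (h : 2 + 1 = 3) {x₀ : M} {y : 𝔼}
    (hy : y ∈ (extChartAt (𝓡 3) x₀).target) (u : VField M) (v : Fin 2 → 𝔼) :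
    chartRep x₀ (star o h (flat u)) y v =
      density o x₀ y * det3 (vfieldRep x₀ u y) (v 0) (v 1) := by
  rw [chartRep_apply, star_flat_apply, ← volForm_chart, vfieldRep, mfderiv_symm_mfderiv_apply hy]

theorem chartRep_crossForm {x₀ : M} {y : 𝔼} (hy : y ∈ (extChartAt (𝓡 3) x₀).target)
    (u w : VField M) (v : Fin 1 → 𝔼) : chartRep x₀ (crossForm o u w) y v =
      density o x₀ y * det3 (vfieldRep x₀ u y) (vfieldRep x₀ w y) (v 0) := by
  rw [chartRep_apply, crossForm_apply, ← volForm_chart, vfieldRep, vfieldRep,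
    mfderiv_symm_mfderiv_apply hy, mfderiv_symm_mfderiv_apply hy]

theorem chartRep_eq_axial {x₀ : M} {y : 𝔼} (hy : y ∈ (extChartAt (𝓡 3) x₀).target) (β : Form M 2)
    (v : Fin 2 → 𝔼) : chartRep x₀ β y v =
      density o x₀ y * det3 (vfieldRep x₀ (axial o β) y) (v 0) (v 1) := by
  rw [← chartRep_star_flat o rfl hy, ← star_two_eq_flat_axial o rfl, star_star_two]

/-- On 3-forms β = (⋆β) dV, so in a chart ⋆β is the quotient of two coefficients, which shows its
smoothness. -/
theorem chartRep_eq_star {x₀ : M} {y : 𝔼} (h : 0 + 3 = 3) (β : Form M 3) (v : Fin 0 → 𝔼) :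
    chartRep x₀ β y ![stdVec 0, stdVec 1, stdVec 2] =
      chartRep x₀ (star o h β) y v * density o x₀ y := by
  set p := (extChartAt (𝓡 3) x₀).symm y with hp
  -- The coefficient of dV is read off on the frame; the sign of the frame is its own inverse.
  have h1 : β p = (β p ![frame3 p 0, frame3 p 1, frame3 p 2] * frameSign o p) • volForm o p := by
    ext w
    rw [alt3_eq_orthonormal (β p) (frame3 p), ContinuousAlternatingMap.smul_apply,
      alt3_eq_orthonormal (volForm o p) (frame3 p) w, smul_eq_mul]
    have h2 := frameSign_sq o p
    rw [show volForm o p ![frame3 p 0, frame3 p 1, frame3 p 2] = frameSign o p from rfl]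
    linear_combination (-(β p ![frame3 p 0, frame3 p 1, frame3 p 2] *
      det3 (fun i => inner ℝ (frame3 p i) (w 0)) (fun i => inner ℝ (frame3 p i) (w 1))
      (fun i => inner ℝ (frame3 p i) (w 2)))) * h2
  have h3 := star_smul_volForm o h _ β p h1
    (fun i => mfderiv 𝓘(ℝ, 𝔼) (𝓡 3) (extChartAt (𝓡 3) x₀).symm y (v i))
  rw [chartRep_apply x₀ (star o h β), h3, density, chartRep_apply, chartRep_apply]
  exact congrArg (fun f : (TangentSpace (𝓡 3) p) [⋀^Fin 3]→L[ℝ] ℝ => f fun i =>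
    mfderiv 𝓘(ℝ, 𝔼) (𝓡 3) (extChartAt (𝓡 3) x₀).symm y
      ((![stdVec 0, stdVec 1, stdVec 2] : Fin 3 → 𝔼) i)) h1

variable [IsContMDiffRiemannianBundle (𝓡 3) ∞ (EuclideanSpace ℝ (Fin 3))
      (fun x : M => TangentSpace (𝓡 3) x)]

variable {o} {J : Set ℝ}

theorem jointForm_star_one (ho : IsSmoothForm (volForm o)) (h : 2 + 1 = 3) {a : ℝ → Form M 1} (ha : JointForm J a) :
    JointForm J (fun t => star o h (a t)) := by
  intro x₀ v
  have hc : ∀ i, ContDiffOn ℝ ∞ (fun p : ℝ × 𝔼 => vfieldRep x₀ (sharp (a p.1)) p.2 i)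
      (J ×ˢ (extChartAt (𝓡 3) x₀).target) := fun i =>
    (EuclideanSpace.proj i : 𝔼 →L[ℝ] ℝ).contDiff.comp_contDiffOn (jointVField_sharp ha x₀)
  have h1 : ContDiffOn ℝ ∞ (fun p : ℝ × 𝔼 => density o x₀ p.2 *
      det3 (vfieldRep x₀ (sharp (a p.1)) p.2) (v 0) (v 1)) (J ×ˢ (extChartAt (𝓡 3) x₀).target) := by
    refine (contDiffOn_density_prod ho x₀).mul ?_
    unfold det3
    exact (((hc 0).mul contDiffOn_const).sub ((hc 1).mul contDiffOn_const)).add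
      ((hc 2).mul contDiffOn_const)
  refine h1.congr fun p hp => ?_
  rw [← chartRep_star_flat o h hp.2, flat_sharp]

/-- In coordinates β = dV(z, ⋅, ⋅) reads β(∂ᵢ, ∂ⱼ) = ρ zₖ for cyclic i, j, k, and this can be solved
for z because the density ρ does not vanish. -/
theorem jointVField_axial (ho : IsSmoothForm (volForm o)) {a : ℝ → Form M 2} (ha : JointForm J a) :
    JointVField J (fun t => axial o (a t)) := by
  intro x₀
  have h1 : ContDiffOn ℝ ∞ (fun p : ℝ × 𝔼 => (density o x₀ p.2)⁻¹ •
      (chartRep x₀ (a p.1) p.2 ![stdVec 1, stdVec 2] • stdVec 0 +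
        chartRep x₀ (a p.1) p.2 ![stdVec 2, stdVec 0] • stdVec 1 +
        chartRep x₀ (a p.1) p.2 ![stdVec 0, stdVec 1] • stdVec 2))
      (J ×ˢ (extChartAt (𝓡 3) x₀).target) := by
    refine ((contDiffOn_density_prod ho x₀).inv fun p hp => density_ne_zero o hp.2).smul ?_
    exact (((ha x₀ _).smul contDiffOn_const).add ((ha x₀ _).smul contDiffOn_const)).add
      ((ha x₀ _).smul contDiffOn_const)
  refine h1.congr fun p hp => ?_
  have hd := density_ne_zero o hp.2
  simp only [chartRep_eq_axial o hp.2]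
  ext i
  fin_cases i <;> simp [det3, stdVec_apply, hd]

theorem jointForm_star_two (ho : IsSmoothForm (volForm o)) (h : 1 + 2 = 3) {a : ℝ → Form M 2} (ha : JointForm J a) :
    JointForm J (fun t => star o h (a t)) := by
  simp only [star_two_eq_flat_axial]
  exact jointForm_flat (jointVField_axial ho ha)

theorem jointForm_star_three (ho : IsSmoothForm (volForm o)) (h : 0 + 3 = 3) {a : ℝ → Form M 3} (ha : JointForm J a) :
    JointForm J (fun t => star o h (a t)) := by
  intro x₀ v
  have h1 : ContDiffOn ℝ ∞ (fun p : ℝ × 𝔼 =>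
      chartRep x₀ (a p.1) p.2 ![stdVec 0, stdVec 1, stdVec 2] * (density o x₀ p.2)⁻¹)
      (J ×ˢ (extChartAt (𝓡 3) x₀).target) :=
    (ha x₀ _).mul ((contDiffOn_density_prod ho x₀).inv fun p hp => density_ne_zero o hp.2)
  refine h1.congr fun p hp => ?_
  have hd := density_ne_zero o hp.2
  rw [chartRep_eq_star o h _ v]
  field_simp

theorem jointForm_codiff_three (ho : IsSmoothForm (volForm o)) (hJ : UniqueDiffOn ℝ J) {a : ℝ → Form M 3} (ha : JointForm J a) :
    JointForm J (fun t => codiff o (a t)) := by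
  simp only [codiff_three]
  exact jointForm_star_one ho _ (jointForm_extD hJ (jointForm_star_three ho _ ha))

end

/-! ### Exterior derivatives of interior products of a volume form on ℝ³ -/

section

section Calculus

/-- The density `ρ` times the divergence of `U` with respect to the volume form with density `ρ`. -/
def divAt (ρ : 𝔼 → ℝ) (U : 𝔼 → 𝔼) (y : 𝔼) : ℝ :=
  fderiv ℝ ρ y (U y) + ρ y * ∑ i, fderiv ℝ U y (stdVec i) i

theorem map_eq_sum_stdVec {F : Type*} [AddCommGroup F] [Module ℝ F] [TopologicalSpace F]
    (L : 𝔼 →L[ℝ] F) (v : 𝔼) :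
    L v = v 0 • L (stdVec 0) + v 1 • L (stdVec 1) + v 2 • L (stdVec 2) := by
  conv_lhs => rw [← sum_smul_stdVec v]
  simp [Fin.sum_univ_three]

variable {ρ : 𝔼 → ℝ} {U W : 𝔼 → 𝔼} {y : 𝔼}

theorem hasFDerivAt_coord (hU : DifferentiableAt ℝ U y) (i : Fin 3) :
    HasFDerivAt (fun z => U z i) ((EuclideanSpace.proj i : 𝔼 →L[ℝ] ℝ).comp (fderiv ℝ U y)) y :=
  (EuclideanSpace.proj i : 𝔼 →L[ℝ] ℝ).hasFDerivAt.comp y hU.hasFDerivAt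

theorem fderiv_mul_det3 (hρ : DifferentiableAt ℝ ρ y) (hU : DifferentiableAt ℝ U y)
    (hW : DifferentiableAt ℝ W y) (a w : 𝔼) :
    fderiv ℝ (fun z => ρ z * det3 (U z) (W z) a) y w =
      fderiv ℝ ρ y w * det3 (U y) (W y) a + ρ y * (det3 (fderiv ℝ U y w) (W y) a +
        det3 (U y) (fderiv ℝ W y w) a) := by
  have hu := hasFDerivAt_coord hU
  have hw := hasFDerivAt_coord hW
  have h := hρ.hasFDerivAt.mul
    ((((hu 0).mul (((hw 1).mul_const (a 2)).sub ((hw 2).mul_const (a 1)))).sub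
      ((hu 1).mul (((hw 0).mul_const (a 2)).sub ((hw 2).mul_const (a 0))))).add
      ((hu 2).mul (((hw 0).mul_const (a 1)).sub ((hw 1).mul_const (a 0)))))
  have h2 : HasFDerivAt (fun z => ρ z * det3 (U z) (W z) a) _ y := h
  rw [h2.fderiv]
  simp [det3]
  ring

/-- This is d(ι_U μ) = (div U) μ for μ with density ρ: the derivative of ρ contributes Dρ(U), and
the derivative of U contributes its trace. -/
theorem extDeriv_interior {β : 𝔼 → 𝔼 [⋀^Fin 2]→L[ℝ] ℝ} (hβ : DifferentiableAt ℝ β y)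
    (hρ : DifferentiableAt ℝ ρ y) (hU : DifferentiableAt ℝ U y)
    (h : ∀ᶠ z in nhds y, ∀ v, β z v = ρ z * det3 (U z) (v 0) (v 1)) (v : Fin 3 → 𝔼) :
    extDeriv β y v = divAt ρ U y * det3 (v 0) (v 1) (v 2) := by
  have hd : ∀ (a : Fin 2 → 𝔼) (w : 𝔼), fderiv ℝ (fun z => β z a) y w =
      fderiv ℝ ρ y w * det3 (U y) (a 0) (a 1) + ρ y * det3 (fderiv ℝ U y w) (a 0) (a 1) := by
    intro a w
    have he : (fun z => β z a) =ᶠ[nhds y] fun z => ρ z * det3 (U z) (a 0) (a 1) := by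
      filter_upwards [h] with z hz using hz a
    rw [he.fderiv_eq, fderiv_mul_det3 hρ hU (differentiableAt_const (a 0))]
    simp [det3]
  rw [extDeriv_apply hβ]
  simp only [hd]
  -- Once every derivative is expanded on the standard basis, the trace identity for determinants is
  -- a polynomial identity in the matrix entries.
  simp only [map_eq_sum_stdVec (fderiv ℝ ρ y) (v _), map_eq_sum_stdVec (fderiv ℝ ρ y) (U _),
    map_eq_sum_stdVec (fderiv ℝ U y) (v _), divAt]
  simp [det3, Fin.removeNth, Fin.succAbove, Fin.sum_univ_three]
  ring

/-- The Cartan calculus gives d ι_W ι_U μ = ι_[W,U] μ + (div W) ι_U μ - (div U) ι_W μ, with [W, U] =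
DU(W) - DW(U) in coordinates. Here it is checked by direct expansion. -/
theorem extDeriv_interior_interior {β : 𝔼 → 𝔼 [⋀^Fin 1]→L[ℝ] ℝ} (hβ : DifferentiableAt ℝ β y)
    (hρ : DifferentiableAt ℝ ρ y) (hU : DifferentiableAt ℝ U y) (hW : DifferentiableAt ℝ W y)
    (h : ∀ᶠ z in nhds y, ∀ v, β z v = ρ z * det3 (U z) (W z) (v 0)) (v : Fin 2 → 𝔼) :
    extDeriv β y v = ρ y * det3 (fderiv ℝ U y (W y) - fderiv ℝ W y (U y)) (v 0) (v 1) +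
      divAt ρ W y * det3 (U y) (v 0) (v 1) - divAt ρ U y * det3 (W y) (v 0) (v 1) := by
  have hd : ∀ (a : Fin 1 → 𝔼) (w : 𝔼), fderiv ℝ (fun z => β z a) y w =
      fderiv ℝ ρ y w * det3 (U y) (W y) (a 0) + ρ y * (det3 (fderiv ℝ U y w) (W y) (a 0) +
        det3 (U y) (fderiv ℝ W y w) (a 0)) := by
    intro a w
    have he : (fun z => β z a) =ᶠ[nhds y] fun z => ρ z * det3 (U z) (W z) (a 0) := by
      filter_upwards [h] with z hz using hz a
    rw [he.fderiv_eq, fderiv_mul_det3 hρ hU hW]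
  rw [extDeriv_apply hβ]
  simp only [hd]
  simp only [map_eq_sum_stdVec (fderiv ℝ ρ y) (v _), map_eq_sum_stdVec (fderiv ℝ ρ y) (U _),
    map_eq_sum_stdVec (fderiv ℝ ρ y) (W _), map_eq_sum_stdVec (fderiv ℝ U y) (W _),
    map_eq_sum_stdVec (fderiv ℝ W y) (U _),
    map_eq_sum_stdVec (fderiv ℝ U y) (v _), map_eq_sum_stdVec (fderiv ℝ W y) (v _), divAt]
  simp [det3, Fin.removeNth, Fin.succAbove, Fin.sum_univ_three]
  ring

end Calculus

end

/-! ### Divergence, curl, and the codifferential of u^♭ ∧ w^♭ -/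

section

section Core

variable {M : Type*} [TopologicalSpace M] [ChartedSpace (EuclideanSpace ℝ (Fin 3)) M]

/-- Smoothness of a vector field in all preferred charts. -/
def IsSmoothVField (u : VField M) : Prop :=
  ∀ x₀ : M, ContDiffOn ℝ ∞ (vfieldRep x₀ u) (extChartAt (𝓡 3) x₀).target

theorem JointVField.isSmoothVField {J : Set ℝ} {u : ℝ → VField M} (hu : JointVField J u) {t : ℝ}
    (ht : t ∈ J) : IsSmoothVField (u t) :=
  fun x₀ => (hu x₀).comp (contDiff_const.prodMk contDiff_id).contDiffOn
    (fun _ hy => Set.mk_mem_prod ht hy)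

theorem IsSmoothVField.jointVField {J : Set ℝ} {u : VField M} (hu : IsSmoothVField u) :
    JointVField J (fun _ => u) :=
  fun x₀ => (hu x₀).comp contDiff_snd.contDiffOn (fun _ hp => hp.2)

theorem vfieldRep_self (x : M) (u : VField M) :
    vfieldRep x u (extChartAt (𝓡 3) x x) = coords x (u x) := by
  -- The base point φ⁻¹(φ(x)) occurs in the types, so the claim is generalized to any p equal to x.
  have h : ∀ p : M, p = x → (mfderiv (𝓡 3) 𝓘(ℝ, 𝔼) (extChartAt (𝓡 3) x) p (u p) : 𝔼) =
      mfderiv (𝓡 3) 𝓘(ℝ, 𝔼) (extChartAt (𝓡 3) x) x (u x) := by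
    rintro p rfl
    rfl
  exact h _ ((extChartAt (𝓡 3) x).left_inv (mem_extChartAt_source x))

theorem extD_apply_coords {k : ℕ} (α : Form M k) (x : M)
    (v : Fin (k + 1) → TangentSpace (𝓡 3) x) :
    extD α x v = extDeriv (chartRep x α) (extChartAt (𝓡 3) x x) (fun i => coords x (v i)) := rfl

variable [IsManifold (𝓡 3) ∞ M]

theorem form_apply_eq_chartRep {k : ℕ} (α : Form M k) (x : M)
    (v : Fin k → TangentSpace (𝓡 3) x) :
    α x v = chartRep x α (extChartAt (𝓡 3) x x) (fun i => coords x (v i)) := by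
  have := isManifold_one (M := M)
  rw [chartRep_apply]
  refine (Form.congr_point α ((extChartAt (𝓡 3) x).left_inv (mem_extChartAt_source x)) _ _
    fun i => ?_).symm
  -- The tangent space at x is modelled by the preferred chart at x, so the derivatives of this
  -- chart and of its inverse are the identity there.
  have h1 := mfderivWithin_range_extChartAt_symm (I := 𝓡 3) (x := x)
  rw [ModelWithCorners.range_eq_univ, mfderivWithin_univ] at h1
  have h2 := mfderiv_extChartAt_self (I := 𝓡 3) (x := x)
  have h3 : coords x (v i) = v i := congrArg (fun f : 𝔼 →L[ℝ] 𝔼 => f (v i)) h2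
  rw [h3]
  exact congrArg (fun f : 𝔼 →L[ℝ] 𝔼 => f (v i)) h1

variable [Bundle.RiemannianBundle (fun x : M => TangentSpace (𝓡 3) x)]

/-- Vanishing torsion: this is the property of the Levi-Civita connection that turns ∇_w u - ∇_u w
into a Lie bracket. -/
theorem christoffel_comm (x : M) (v w z : TangentSpace (𝓡 3) x) :
    christoffel x v w z = christoffel x w v z := by
  have h : metricRep x (coords x v) (coords x w) = metricRep x (coords x w) (coords x v) :=
    funext fun y => metricRep_comm x _ _ y
  rw [christoffel, christoffel, h]
  ring

theorem coords_covD_sub (u w : VField M) (x : M) :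
    coords x ((covD w u - covD u w) x) =
      fderiv ℝ (vfieldRep x u) (extChartAt (𝓡 3) x x) (vfieldRep x w (extChartAt (𝓡 3) x x)) -
      fderiv ℝ (vfieldRep x w) (extChartAt (𝓡 3) x x) (vfieldRep x u (extChartAt (𝓡 3) x x)) := by
  have := isManifold_one (M := M)
  have h2 : (mfderiv (𝓡 3) 𝓘(ℝ, 𝔼) (extChartAt (𝓡 3) x) x : 𝔼 →L[ℝ] 𝔼) =
    ContinuousLinearMap.id ℝ 𝔼 := mfderiv_extChartAt_self (I := 𝓡 3) (x := x)
  have h3 : ∀ v : TangentSpace (𝓡 3) x, coords x v = v := fun v =>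
    congrArg (fun f : 𝔼 →L[ℝ] 𝔼 => f v) h2
  have h4 : ∀ v : 𝔼, ((mfderiv (𝓡 3) 𝓘(ℝ, 𝔼) (extChartAt (𝓡 3) x) x).inverse v : 𝔼) = v := fun v =>
    (congrArg (fun f : 𝔼 →L[ℝ] 𝔼 => f.inverse v) h2).trans (by rw [ContinuousLinearMap.inverse_id]; rfl)
  -- Only the coordinate derivative is named z; the Christoffel sums stay explicit, so that they
  -- cancel by symmetry.
  have h5 : ∀ a b : VField M, ∃ z : TangentSpace (𝓡 3) x,
      (z : 𝔼) = fderiv ℝ (vfieldRep x b) (extChartAt (𝓡 3) x x) (coords x (a x)) ∧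
      covD a b x = z + ∑ i, christoffel x (a x) (b x) (frame x i) • frame x i := fun a b =>
    ⟨_, h4 _, rfl⟩
  obtain ⟨z, hz, hz'⟩ := h5 w u
  obtain ⟨z₂, hz₂, hz₂'⟩ := h5 u w
  rw [h3, Pi.sub_apply, vfieldRep_self, vfieldRep_self, ← hz, ← hz₂, hz', hz₂']
  simp only [christoffel_comm x (u x) (w x)]
  exact add_sub_add_right_eq_sub z z₂ _

variable [IsContMDiffRiemannianBundle (𝓡 3) ∞ (EuclideanSpace ℝ (Fin 3))
      (fun x : M => TangentSpace (𝓡 3) x)]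
  {o : ∀ x : M, Orientation ℝ (TangentSpace (𝓡 3) x) (Fin 3)}

/-- A static field is a jointly smooth one that is constant in time, on the interval ℝ; the static
statements that follow are specialized in this way. -/
theorem isSmoothForm_flat {u : VField M} (hu : IsSmoothVField u) : IsSmoothForm (flat u) :=
  (jointForm_flat (J := Set.univ) hu.jointVField).isSmoothForm (Set.mem_univ 0)

theorem isSmoothVField_sharp {α : Form M 1} (hα : IsSmoothForm α) : IsSmoothVField (sharp α) :=
  (jointVField_sharp (J := Set.univ) hα.jointForm).isSmoothVField (Set.mem_univ 0)

theorem isSmoothForm_extD {k : ℕ} {α : Form M k} (hα : IsSmoothForm α) : IsSmoothForm (extD α) :=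
  (jointForm_extD uniqueDiffOn_univ hα.jointForm).isSmoothForm (Set.mem_univ 0)

theorem isSmoothForm_wedge {p q k : ℕ} (h : p + q = k) {α : Form M p} {β : Form M q}
    (hα : IsSmoothForm α) (hβ : IsSmoothForm β) : IsSmoothForm (wedgeForm h α β) :=
  (jointForm_wedge h (J := Set.univ) hα.jointForm hβ.jointForm).isSmoothForm (Set.mem_univ 0)

theorem isSmoothForm_star_one (ho : IsSmoothForm (volForm o)) (h : 2 + 1 = 3) {α : Form M 1}
    (hα : IsSmoothForm α) : IsSmoothForm (star o h α) :=
  (jointForm_star_one ho h (J := Set.univ) hα.jointForm).isSmoothForm (Set.mem_univ 0)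

theorem isSmoothForm_star_two (ho : IsSmoothForm (volForm o)) (h : 1 + 2 = 3) {α : Form M 2}
    (hα : IsSmoothForm α) : IsSmoothForm (star o h α) :=
  (jointForm_star_two ho h (J := Set.univ) hα.jointForm).isSmoothForm (Set.mem_univ 0)

theorem isSmoothForm_star_three (ho : IsSmoothForm (volForm o)) (h : 0 + 3 = 3) {α : Form M 3}
    (hα : IsSmoothForm α) : IsSmoothForm (star o h α) :=
  (jointForm_star_three ho h (J := Set.univ) hα.jointForm).isSmoothForm (Set.mem_univ 0)

theorem isSmoothVField_curl (ho : IsSmoothForm (volForm o)) {u : VField M}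
    (hu : IsSmoothVField u) : IsSmoothVField (curl o u) :=
  isSmoothVField_sharp (isSmoothForm_star_two ho _ (isSmoothForm_extD (isSmoothForm_flat hu)))

theorem volForm_eq_density (x : M) (a b c : TangentSpace (𝓡 3) x) :
    volForm o x ![a, b, c] = density o x (extChartAt (𝓡 3) x x) *
      det3 (coords x a) (coords x b) (coords x c) := by
  rw [form_apply_eq_chartRep, ← chartRep_volForm]
  congr 1
  ext i; fin_cases i <;> rfl

theorem IsSmoothVField.differentiableAt {u : VField M} (hu : IsSmoothVField u) (x : M) :
    DifferentiableAt ℝ (vfieldRep x u) (extChartAt (𝓡 3) x x) :=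
  ((hu x).contDiffAt ((isOpen_extChartAt_target x).mem_nhds
    (mem_extChartAt_target x))).differentiableAt (by simp)

theorem differentiableAt_density (ho : IsSmoothForm (volForm o)) (x : M) :
    DifferentiableAt ℝ (density o x) (extChartAt (𝓡 3) x x) :=
  ((contDiffOn_density ho x).contDiffAt ((isOpen_extChartAt_target x).mem_nhds
    (mem_extChartAt_target x))).differentiableAt (by simp)

theorem IsSmoothForm.differentiableAt {k : ℕ} {α : Form M k} (hα : IsSmoothForm α) (x : M) :
    DifferentiableAt ℝ (chartRep x α) (extChartAt (𝓡 3) x x) :=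
  (hα.contDiffAt (mem_extChartAt_target x)).differentiableAt (by simp)

/-- Since ⋆u^♭ = dV(u, ⋅, ⋅), the function ⋆d⋆u^♭ is the classical divergence with respect to dV. -/
theorem divergence_apply (ho : IsSmoothForm (volForm o)) {u : VField M} (hu : IsSmoothVField u)
    (x : M) (v : Fin 0 → TangentSpace (𝓡 3) x) :
    divergence o u x v = (density o x (extChartAt (𝓡 3) x x))⁻¹ *
      divAt (density o x) (vfieldRep x u) (extChartAt (𝓡 3) x x) := by
  rw [divergence, codiff_one]
  refine star_smul_volForm o _ _ _ x ?_ v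
  have hd := density_ne_zero o (mem_extChartAt_target (I := 𝓡 3) x)
  ext w
  have hw : w = ![w 0, w 1, w 2] := by ext i; fin_cases i <;> rfl
  rw [extD_apply_coords, extDeriv_interior
    ((isSmoothForm_star_one ho _ (isSmoothForm_flat hu)).differentiableAt x)
    (differentiableAt_density ho x) (hu.differentiableAt x),
    ContinuousAlternatingMap.smul_apply, hw, volForm_eq_density, smul_eq_mul]
  · simp only [Matrix.cons_val]
    field_simp
  · filter_upwards [(isOpen_extChartAt_target x).mem_nhds (mem_extChartAt_target (I := 𝓡 3) x)]
      with z hz a using chartRep_star_flat o _ hz u a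

theorem divAt_eq_zero (ho : IsSmoothForm (volForm o)) {u : VField M} (hu : IsSmoothVField u)
    (h : divergence o u = 0) (x : M) :
    divAt (density o x) (vfieldRep x u) (extChartAt (𝓡 3) x x) = 0 := by
  have hd := density_ne_zero o (mem_extChartAt_target (I := 𝓡 3) x)
  have h1 := divergence_apply ho hu x ![]
  rw [h] at h1
  have h2 : (density o x (extChartAt (𝓡 3) x x))⁻¹ *
    divAt (density o x) (vfieldRep x u) (extChartAt (𝓡 3) x x) = 0 := h1.symm
  exact (mul_eq_zero.1 h2).resolve_left (inv_ne_zero hd)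

theorem isSmoothForm_crossForm (ho : IsSmoothForm (volForm o)) {u w : VField M}
    (hu : IsSmoothVField u) (hw : IsSmoothVField w) : IsSmoothForm (crossForm o u w) := by
  rw [← star_wedge_flat o rfl rfl]
  exact isSmoothForm_star_two ho _
    (isSmoothForm_wedge _ (isSmoothForm_flat hu) (isSmoothForm_flat hw))

/-- On 2-forms δ = -⋆d⋆. The inner ⋆ gives dV(u, w, ⋅); the divergence terms of its exterior
derivative vanish, leaving dV([w, u], ⋅, ⋅); the outer ⋆ returns the bracket as a 1-form. -/
theorem codiff_wedge_flat (ho : IsSmoothForm (volForm o)) (h : 1 + 1 = 2) {u w : VField M}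
    (hu : IsSmoothVField u) (hw : IsSmoothVField w) (hdu : divergence o u = 0)
    (hdw : divergence o w = 0) :
    codiff o (wedgeForm h (flat u) (flat w)) = -flat (covD w u - covD u w) := by
  rw [codiff_two, star_wedge_flat]
  congr 1
  funext x
  refine star_interior_apply o _ _ _ x fun v => ?_
  rw [extD_apply_coords, extDeriv_interior_interior ((isSmoothForm_crossForm ho hu hw).differentiableAt x)
    (differentiableAt_density ho x) (hu.differentiableAt x) (hw.differentiableAt x),
    divAt_eq_zero ho hu hdu, divAt_eq_zero ho hw hdw, volForm_eq_density, coords_covD_sub]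
  · simp only [zero_mul, add_zero, sub_zero]
    rfl
  · filter_upwards [(isOpen_extChartAt_target x).mem_nhds (mem_extChartAt_target (I := 𝓡 3) x)]
      with z hz a using chartRep_crossForm o hz u w a

theorem star_zero {k l : ℕ} (h : l + k = 3) : star o h (0 : Form M k) = 0 := by
  funext x
  simp [star]

theorem codiff_star_extD (h : 1 + 2 = 3) {α : Form M 1} (hα : IsSmoothForm α) :
    codiff o (star o h (extD α)) = 0 := by
  rw [codiff_one, star_star_two, extD_extD hα, star_zero]

theorem divergence_curl {u : VField M} (hu : IsSmoothVField u) : divergence o (curl o u) = 0 := by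
  rw [divergence, curl, flat_sharp, codiff_star_extD _ (isSmoothForm_flat hu)]

theorem codiff_codiff_three (ho : IsSmoothForm (volForm o)) {α : Form M 3}
    (hα : IsSmoothForm α) : codiff o (codiff o α) = 0 := by
  rw [codiff_two, codiff_three, star_star_one, extD_extD (isSmoothForm_star_three ho _ hα),
    star_zero, neg_zero]

theorem extD_sum {k : ℕ} {ι : Type*} (s : Finset ι) {a : ι → Form M k}
    (ha : ∀ i ∈ s, IsSmoothForm (a i)) : extD (∑ i ∈ s, a i) = ∑ i ∈ s, extD (a i) := by
  have h : ∀ x : M, chartRep x (∑ i ∈ s, a i) = fun y => ∑ i ∈ s, chartRep x (a i) y := fun x => by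
    funext y
    ext v
    simp only [chartRep_apply, Finset.sum_apply, ContinuousAlternatingMap.sum_apply]
  funext x
  ext v
  simp only [extD_apply_coords, extDeriv, Finset.sum_apply, ContinuousAlternatingMap.sum_apply]
  rw [h, fderiv_fun_sum fun i hi => (ha i hi).differentiableAt x]
  change ContinuousAlternatingMap.alternatizeUncurryFinCLM ℝ 𝔼 ℝ _ _ = _
  rw [map_sum, ContinuousAlternatingMap.sum_apply]
  rfl

theorem star_sum {k l : ℕ} (h : l + k = 3) {ι : Type*} (s : Finset ι) (a : ι → Form M k) :
    star o h (∑ i ∈ s, a i) = ∑ i ∈ s, star o h (a i) := by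
  funext x
  simp only [star, Finset.sum_apply, ContinuousAlternatingMap.sum_apply, Finset.sum_smul]
  rw [Finset.sum_comm, Finset.smul_sum]

theorem extD_smul {k : ℕ} (c : ℝ) (a : Form M k) : extD (c • a) = c • extD a := by
  have h : ∀ x : M, chartRep x (c • a) = c • chartRep x a := fun x => rfl
  funext x
  ext v
  simp only [extD_apply_coords, h, extDeriv_smul]
  rfl

theorem star_smul {k l : ℕ} (h : l + k = 3) (c : ℝ) (a : Form M k) :
    star o h (c • a) = c • star o h a := by
  funext x
  simp only [star, Pi.smul_apply, ContinuousAlternatingMap.smul_apply, smul_assoc]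
  rw [← Finset.smul_sum, smul_comm]

theorem codiff_smul {k : ℕ} (c : ℝ) (a : Form M (k + 1)) : codiff o (c • a) = c • codiff o a := by
  unfold codiff
  split_ifs
  · rw [star_smul, extD_smul, star_smul, smul_comm]
  · simp

theorem codiff_zero {k : ℕ} : codiff o (0 : Form M (k + 1)) = 0 := by
  have h := codiff_smul (o := o) 0 (0 : Form M (k + 1))
  rwa [zero_smul, zero_smul] at h

theorem codiff_two_sum (ho : IsSmoothForm (volForm o)) {ι : Type*} (s : Finset ι) {a : ι → Form M 2}
    (ha : ∀ i ∈ s, IsSmoothForm (a i)) : codiff o (∑ i ∈ s, a i) = ∑ i ∈ s, codiff o (a i) := by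
  simp only [codiff_two]
  rw [star_sum, extD_sum _ fun i hi => isSmoothForm_star_two ho _ (ha i hi), star_sum,
    Finset.sum_neg_distrib]

end Core

end

/-! ### The graded algebra with time-dependent coefficients -/

section

section Wedge

variable {W : Type*} [AddCommGroup W] [Module ℝ W] [TopologicalSpace W]

theorem wedge_zero_left {p q k : ℕ} (h : p + q = k) (β : W [⋀^Fin q]→L[ℝ] ℝ) :
    wedge h (0 : W [⋀^Fin p]→L[ℝ] ℝ) β = 0 := by
  ext v
  simp [wedge_apply]

theorem wedge_zero_right {p q k : ℕ} (h : p + q = k) (α : W [⋀^Fin p]→L[ℝ] ℝ) :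
    wedge h α (0 : W [⋀^Fin q]→L[ℝ] ℝ) = 0 := by
  ext v
  simp [wedge_apply]

theorem wedge_one_left {k : ℕ} (h : 0 + k = k) (β : W [⋀^Fin k]→L[ℝ] ℝ) :
    wedge h (ContinuousAlternatingMap.constOfIsEmpty ℝ W (Fin 0) (1 : ℝ)) β = β := by
  ext v
  -- Each permutation contributes β v, because its sign cancels against the alternation of β. The k!
  -- equal terms then cancel the normalization.
  have hσ : ∀ σ : Equiv.Perm (Fin k), Equiv.Perm.sign σ •
      (ContinuousAlternatingMap.constOfIsEmpty ℝ W (Fin 0) (1 : ℝ)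
        (fun i => v (σ (Fin.cast h (Fin.castAdd k i)))) *
        β (fun i => v (σ (Fin.cast h (Fin.natAdd 0 i))))) = β v := fun σ => by
    have h1 : (fun i => v (σ (Fin.cast h (Fin.natAdd 0 i)))) = v ∘ σ := by
      funext i
      have : Fin.cast h (Fin.natAdd 0 i) = i := by ext; simp
      rw [this]; rfl
    have h2 : β (v ∘ σ) = Equiv.Perm.sign σ • β v := β.toAlternatingMap.map_perm v σ
    rw [h1, h2]
    simp [smul_smul]
  rw [wedge_apply]
  simp only [hσ, Finset.sum_const, Finset.card_univ, Fintype.card_perm, Fintype.card_fin]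
  have : (k.factorial : ℝ) ≠ 0 := by positivity
  simp
  field_simp

theorem wedge_one_one_comm (h : 1 + 1 = 2) (α β : W [⋀^Fin 1]→L[ℝ] ℝ) :
    wedge h β α = -wedge h α β := by
  ext v
  rw [ContinuousAlternatingMap.neg_apply, wedge_one_one_apply, wedge_one_one_apply]
  ring

end Wedge

variable {M : Type*} [TopologicalSpace M] [ChartedSpace (EuclideanSpace ℝ (Fin 3)) M]

theorem wedgeForm_zero_left {p q k : ℕ} (h : p + q = k) (β : Form M q) :
    wedgeForm h (0 : Form M p) β = 0 :=
  funext fun x => wedge_zero_left h (β x)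

theorem wedgeForm_zero_right {p q k : ℕ} (h : p + q = k) (α : Form M p) :
    wedgeForm h α (0 : Form M q) = 0 :=
  funext fun x => wedge_zero_right h (α x)

theorem wedgeForm_neg_right (h : 1 + 1 = 2) (α β : Form M 1) :
    wedgeForm h α (-β) = -wedgeForm h α β := by
  funext x
  ext v
  change wedge h (α x) (-β x) v = -wedge h (α x) (β x) v
  simp only [wedge_one_one_apply, ContinuousAlternatingMap.neg_apply]
  ring

namespace TimeDomain

/-- The pairs of indices that contribute to the coefficient at an index of a product. -/
def pairs : (τ : TimeDomain) → τ.Index → Finset (τ.Index × τ.Index)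
  | point, i => {(i, i)}
  | formal, n => (Finset.HasAntidiagonal.antidiagonal (A := ℕ) n : Finset (ℕ × ℕ))
  | interval _, t => {(t, t)}

/-- This treats all senses of time uniformly: bilinear identities may be proved pair by pair. -/
theorem lift_eq_sum {A B C : Type*} [AddCommMonoid C] (op : A → B → C) (τ : TimeDomain)
    (a : τ.Index → A) (b : τ.Index → B) (i : τ.Index) :
    τ.lift op a b i = ∑ p ∈ τ.pairs i, op (a p.1) (b p.2) := by
  cases τ with
  | point => exact (Finset.sum_singleton _ _).symm
  | formal => rfl
  | interval J => exact (Finset.sum_singleton (fun p : ℝ × ℝ => op (a p.1) (b p.2)) (i, i)).symm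

theorem mem_dom_of_mem_pairs {τ : TimeDomain} {i : τ.Index} (hi : i ∈ τ.dom)
    {p : τ.Index × τ.Index} (hp : p ∈ τ.pairs i) : p.1 ∈ τ.dom ∧ p.2 ∈ τ.dom := by
  cases τ with
  | point => exact ⟨trivial, trivial⟩
  | formal => exact ⟨trivial, trivial⟩
  | interval J =>
    obtain rfl : p = (i, i) := Finset.mem_singleton.1 hp
    exact ⟨hi, hi⟩

/-- Commutativity of the algebra of time coefficients, needed whenever two factors change places. -/
theorem sum_pairs_swap {C : Type*} [AddCommMonoid C] {τ : TimeDomain} (i : τ.Index)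
    (F : τ.Index → τ.Index → C) : ∑ p ∈ τ.pairs i, F p.1 p.2 = ∑ p ∈ τ.pairs i, F p.2 p.1 := by
  cases τ with
  | point => rfl
  | formal =>
    exact (Finset.Nat.sum_antidiagonal_swap (n := i) (f := fun p : ℕ × ℕ => F p.2 p.1))
  | interval J =>
    exact (Finset.sum_singleton (fun p : ℝ × ℝ => F p.1 p.2) (i, i)).trans
      (Finset.sum_singleton (fun p : ℝ × ℝ => F p.2 p.1) (i, i)).symm

theorem lift_const_left {A B C : Type*} [Zero A] [AddCommMonoid C] (op : A → B → C)
    (h0 : ∀ b, op 0 b = 0) (τ : TimeDomain) (a : A) (b : τ.Index → B) (i : τ.Index) :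
    τ.lift op (τ.const a) b i = op a (b i) := by
  cases τ with
  | point => rfl
  | formal =>
    refine (Finset.sum_eq_single ((0 : ℕ), (i : ℕ)) ?_ ?_).trans ?_
    · rintro ⟨m, n⟩ hmn hne
      have hm : m ≠ 0 := by
        rintro rfl
        apply hne
        have h1 : (0 : ℕ) + (show ℕ from n) = (show ℕ from i) := Finset.HasAntidiagonal.mem_antidiagonal.1 hmn
        exact congrArg (Prod.mk 0) ((zero_add (M := ℕ) n).symm.trans h1)
      have : (formal.const a : ℕ → A) m = 0 := if_neg hm
      exact (congrArg (fun z => op z (b n)) this).trans (h0 _)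
    · intro h
      exact absurd (Finset.HasAntidiagonal.mem_antidiagonal.2 (zero_add _)) h
    · rfl
  | interval J => rfl

section ddt

variable {X : Type*} {F : X → Type*} [∀ x, NormedAddCommGroup (F x)] [∀ x, NormedSpace ℝ (F x)]

/-- Values outside `dom` do not matter: for functions of time, the derivative is taken within J. -/
theorem ddt_congr {τ : TimeDomain} {a b : τ.Index → ∀ x, F x} (h : ∀ i ∈ τ.dom, a i = b i)
    {i : τ.Index} (hi : i ∈ τ.dom) : τ.ddt a i = τ.ddt b i := by
  cases τ with
  | point => rfl
  | formal =>
    have : a = b := funext fun i => h i trivial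
    rw [this]
  | interval J =>
    funext x
    exact derivWithin_congr (fun t ht => congrFun (h t ht) x) (congrFun (h i hi) x)

theorem ddt_zero {τ : TimeDomain} (i : τ.Index) : τ.ddt (fun _ => (0 : ∀ x, F x)) i = 0 := by
  cases τ with
  | point => rfl
  | formal => funext x; exact smul_zero _
  | interval J =>
    funext x
    exact congrFun (derivWithin_const (s := J) (0 : F x)) i

theorem ddt_const {τ : TimeDomain} (c : ∀ x, F x) (i : τ.Index) : τ.ddt (τ.const c) i = 0 := by
  cases τ with
  | point => rfl
  | formal => funext x; exact smul_zero _
  | interval J =>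
    funext x
    exact congrFun (derivWithin_const (s := J) (c x)) i

end ddt

end TimeDomain

namespace Elt

variable {τ : TimeDomain}

theorem mul_eq_zero {Y Z : Elt M τ} {a b : Fin 2} {k : ℕ} {i : τ.Index}
    (h : ∀ a₁ ≤ a, ∀ b₁ ≤ b, ∀ p q, p + q = k → ∀ j ∈ τ.pairs i,
      Y a₁ b₁ p j.1 = 0 ∨ Z (a - a₁) (b - b₁) q j.2 = 0) : mul Y Z a b k i = 0 := by
  simp only [mul, Finset.sum_apply, Pi.smul_apply]
  refine Finset.sum_eq_zero fun a₁ ha => Finset.sum_eq_zero fun b₁ hb =>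
    Finset.sum_eq_zero fun pq _ => ?_
  rw [TimeDomain.lift_eq_sum, Finset.sum_eq_zero, smul_zero]
  intro j hj
  rcases h a₁ (Finset.mem_Iic.1 ha) b₁ (Finset.mem_Iic.1 hb) pq.1.1 pq.1.2
    (Finset.HasAntidiagonal.mem_antidiagonal.1 pq.2) j hj with h | h
  · rw [h, wedgeForm_zero_left]
  · rw [h, wedgeForm_zero_right]

theorem one_eq_zero {a b : Fin 2} {k : ℕ} (h : ¬(a = 0 ∧ b = 0 ∧ k = 0)) :
    (one : Elt M τ) a b k = fun _ => 0 := by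
  unfold one
  split
  · exact absurd ⟨rfl, rfl, rfl⟩ h
  · rfl

theorem one_mul (Y : Elt M τ) : mul one Y = Y := by
  funext a b k i
  have hz : ∀ a₁ b₁ (pq : {x // x ∈ Finset.HasAntidiagonal.antidiagonal k}),
      ¬(a₁ = 0 ∧ b₁ = 0 ∧ pq.1.1 = 0) → ∀ a' b',
      τ.lift (wedgeForm (Finset.HasAntidiagonal.mem_antidiagonal.1 pq.2)) ((one : Elt M τ) a₁ b₁ pq.1.1)
        (Y a' b' pq.1.2) i = 0 := fun a₁ b₁ pq h a' b' => by
    rw [TimeDomain.lift_eq_sum, one_eq_zero h]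
    exact Finset.sum_eq_zero fun j _ => wedgeForm_zero_left _ _
  simp only [mul, Finset.sum_apply, Pi.smul_apply]
  -- The unit lives in parameter degrees (0, 0) and form degree 0, so a single term of the triple
  -- sum survives.
  rw [Finset.sum_eq_single 0, Finset.sum_eq_single 0, Finset.sum_eq_single ⟨(0, k), by simp⟩]
  · have h1 := TimeDomain.lift_const_left (wedgeForm (M := M) (zero_add k))
      (fun β => wedgeForm_zero_left _ β) τ (fun x =>
      ContinuousAlternatingMap.constOfIsEmpty ℝ (TangentSpace (𝓡 3) x) (Fin 0) (1 : ℝ))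
      (Y a b k) i
    have h2 : wedgeForm (M := M) (zero_add k) (fun x =>
      ContinuousAlternatingMap.constOfIsEmpty ℝ (TangentSpace (𝓡 3) x) (Fin 0) (1 : ℝ))
      (Y a b k i) = Y a b k i := funext fun x => wedge_one_left _ _
    rw [h2] at h1
    refine Eq.trans ?_ h1
    simp
    rfl
  · rintro pq - hpq
    rw [hz, smul_zero]
    rintro ⟨-, -, h⟩
    apply hpq
    ext
    exact h
  · simp
  · intro b₁ _ hb
    exact Finset.sum_eq_zero fun pq _ => by rw [hz _ _ _ (fun h => hb h.2.1), smul_zero]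
  · simp
  · intro a₁ _ ha
    exact Finset.sum_eq_zero fun b₁ _ => Finset.sum_eq_zero fun pq _ => by
      rw [hz _ _ _ (fun h => ha h.1), smul_zero]
  · simp

end Elt

end

/-! ### The exponential of a reduced element and its closedness -/

section

variable {M : Type*} [TopologicalSpace M] [ChartedSpace (EuclideanSpace ℝ (Fin 3)) M]

namespace Elt

variable {τ : TimeDomain}

/-- A degree zero element without component of form degree zero. -/
def IsReduced (Y : Elt M τ) : Prop :=
  ∀ i ∈ τ.dom, ∀ (a b : Fin 2) (k : ℕ), k ≠ (a : ℕ) + (b : ℕ) ∨ (a = 0 ∧ b = 0) → Y a b k i = 0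

/-- A nonzero component carries dt or ε, and its form degree counts the parameters it carries. As dt
and ε square to zero, two such components multiply to something nonzero only in dt ε and form degree
2. -/
theorem IsReduced.mul_eq_zero {Y : Elt M τ} (hY : IsReduced Y) {a b : Fin 2} {k : ℕ}
    (h : ¬(a = 1 ∧ b = 1 ∧ k = 2)) {i : τ.Index} (hi : i ∈ τ.dom) : mul Y Y a b k i = 0 := by
  refine Elt.mul_eq_zero fun a₁ ha b₁ hb p q hpq j hj => ?_
  obtain ⟨hj1, hj2⟩ := TimeDomain.mem_dom_of_mem_pairs hi hj
  by_cases h1 : p ≠ (a₁ : ℕ) + (b₁ : ℕ) ∨ (a₁ = 0 ∧ b₁ = 0)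
  · exact Or.inl (hY _ hj1 _ _ _ h1)
  · refine Or.inr (hY _ hj2 _ _ _ ?_)
    clear hY
    revert a₁ b₁
    revert a b
    intro a b
    fin_cases a <;> fin_cases b <;> intro h a₁ ha b₁ hb <;> fin_cases a₁ <;> fin_cases b₁ <;>
      simp at * <;> omega

/-- Y² already uses up both dt and ε, so another factor, which has no parameter-free component,
annihilates it. -/
theorem IsReduced.npow_eq_zero {Y : Elt M τ} (hY : IsReduced Y) (n : ℕ) (a b : Fin 2) (k : ℕ)
    {i : τ.Index} (hi : i ∈ τ.dom) : npow Y (n + 3) a b k i = 0 := by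
  induction n generalizing a b k i with
  | zero =>
    change mul (mul (mul one Y) Y) Y a b k i = 0
    rw [one_mul]
    refine Elt.mul_eq_zero fun a₁ ha b₁ hb p q hpq j hj => ?_
    obtain ⟨hj1, hj2⟩ := TimeDomain.mem_dom_of_mem_pairs hi hj
    by_cases h1 : a₁ = 1 ∧ b₁ = 1 ∧ p = 2
    · refine Or.inr (hY _ hj2 _ _ _ (Or.inr ?_))
      obtain ⟨rfl, rfl, -⟩ := h1
      revert ha hb
      fin_cases a <;> fin_cases b <;> simp
    · exact Or.inl (hY.mul_eq_zero h1 hj1)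
  | succ n ih =>
    exact Elt.mul_eq_zero fun a₁ _ b₁ _ p q _ j hj =>
      Or.inl (ih a₁ b₁ p (TimeDomain.mem_dom_of_mem_pairs hi hj).1)

/-- Moving dt past V gives (X dt)(V ε) = -X ∧ V dt ε. In (V ε)(X dt) the sign of moving ε past X
cancels that of moving it past dt, giving V ∧ X dt ε, which is again -X ∧ V dt ε. -/
theorem mul_one_one_two {Y : Elt M τ} (hY : IsReduced Y) {i : τ.Index} (hi : i ∈ τ.dom) :
    mul Y Y 1 1 2 i = (-2 : ℝ) • τ.lift (wedgeForm (rfl : 1 + 1 = 2)) (Y 1 0 1) (Y 0 1 1) i := by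
  have hz : ∀ (a₁ b₁ : Fin 2) (pq : {x // x ∈ Finset.HasAntidiagonal.antidiagonal 2}),
      (pq.1.1 ≠ (a₁ : ℕ) + (b₁ : ℕ) ∨ (a₁ = 0 ∧ b₁ = 0)) → ∀ a' b',
      τ.lift (wedgeForm (Finset.HasAntidiagonal.mem_antidiagonal.1 pq.2)) (Y a₁ b₁ pq.1.1)
        (Y a' b' pq.1.2) i = 0 := fun a₁ b₁ pq h a' b' => by
    rw [TimeDomain.lift_eq_sum]
    refine Finset.sum_eq_zero fun j hj => ?_
    rw [hY _ (TimeDomain.mem_dom_of_mem_pairs hi hj).1 _ _ _ h, wedgeForm_zero_left]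
  have hz' : ∀ (a₁ b₁ : Fin 2) (pq : {x // x ∈ Finset.HasAntidiagonal.antidiagonal 2}),
      τ.lift (wedgeForm (Finset.HasAntidiagonal.mem_antidiagonal.1 pq.2)) (Y a₁ b₁ pq.1.1)
        (Y 0 0 pq.1.2) i = 0 := fun a₁ b₁ pq => by
    rw [TimeDomain.lift_eq_sum]
    refine Finset.sum_eq_zero fun j hj => ?_
    rw [hY _ (TimeDomain.mem_dom_of_mem_pairs hi hj).2 _ _ _ (Or.inr ⟨rfl, rfl⟩),
      wedgeForm_zero_right]
  have h11 : (1, 1) ∈ Finset.HasAntidiagonal.antidiagonal 2 := by simp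
  have hs : ∀ (a₁ b₁ : Fin 2) (c : {x // x ∈ Finset.HasAntidiagonal.antidiagonal 2} → ℝ) (a' b' : Fin 2),
      (a₁ : ℕ) + (b₁ : ℕ) = 1 →
      ∑ pq ∈ (Finset.HasAntidiagonal.antidiagonal 2).attach, c pq •
        τ.lift (wedgeForm (Finset.HasAntidiagonal.mem_antidiagonal.1 pq.2)) (Y a₁ b₁ pq.1.1)
          (Y a' b' pq.1.2) i =
      c ⟨(1, 1), h11⟩ • τ.lift (wedgeForm (rfl : 1 + 1 = 2)) (Y a₁ b₁ 1) (Y a' b' 1) i := by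
    intro a₁ b₁ c a' b' hab
    refine Finset.sum_eq_single (⟨(1, 1), h11⟩ : {x // x ∈ Finset.HasAntidiagonal.antidiagonal 2})
      ?_ ?_
    · intro pq _ hpq
      rw [hz _ _ _ (Or.inl ?_), smul_zero]
      intro h
      apply hpq
      ext
      exact h.trans hab
    · exact fun h => absurd (Finset.mem_attach _ _) h
  have hV : τ.lift (wedgeForm (rfl : 1 + 1 = 2)) (Y 0 1 1) (Y 1 0 1) i =
      -τ.lift (wedgeForm (rfl : 1 + 1 = 2)) (Y 1 0 1) (Y 0 1 1) i := by
    rw [TimeDomain.lift_eq_sum, TimeDomain.lift_eq_sum, ← Finset.sum_neg_distrib,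
      TimeDomain.sum_pairs_swap i (fun p q => wedgeForm (rfl : 1 + 1 = 2) (Y 0 1 1 p) (Y 1 0 1 q))]
    exact Finset.sum_congr rfl fun p _ => funext fun x => wedge_one_one_comm _ _ _
  have hI : (Finset.Iic (1 : Fin 2)) = {0, 1} := by decide
  simp only [mul, Finset.sum_apply, Pi.smul_apply]
  rw [hI, Finset.sum_pair (by decide), Finset.sum_pair (by decide), Finset.sum_pair (by decide),
    hs 0 1 _ _ _ rfl, hs 1 0 _ _ _ rfl]
  -- The two remaining splittings have a factor in parameter degrees (0, 0), which vanishes for a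
  -- reduced element.
  rw [Finset.sum_eq_zero, Finset.sum_eq_zero (s := (Finset.HasAntidiagonal.antidiagonal 2).attach)]
  · simp only [sub_zero, sub_self, hV]
    norm_num
    module
  · intro pq _
    exact (congrArg _ (hz' 1 1 pq)).trans (smul_zero _)
  · intro pq _
    rw [hz _ _ _ (Or.inr ⟨rfl, rfl⟩), smul_zero]

variable [Bundle.RiemannianBundle (fun x : M => TangentSpace (𝓡 3) x)]

theorem exp_eq {Y : Elt M τ} (hY : IsReduced Y) (a b : Fin 2) (k : ℕ) {i : τ.Index}
    (hi : i ∈ τ.dom) :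
    exp Y a b k i = (one : Elt M τ) a b k i + Y a b k i + (2⁻¹ : ℝ) • mul Y Y a b k i := by
  funext x
  have h : ∀ n ∉ Finset.range 3, ((n.factorial : ℝ)⁻¹ • (npow Y n) a b k i x) = 0 := by
    intro n hn
    obtain ⟨m, rfl⟩ := Nat.exists_eq_add_of_le' (not_lt.1 fun h => hn (Finset.mem_range.2 h))
    rw [hY.npow_eq_zero m a b k hi]
    exact smul_zero _
  rw [exp, tsum_eq_sum h, Finset.sum_range_succ, Finset.sum_range_succ, Finset.sum_range_one]
  have h1 : npow Y 1 = Y := one_mul Y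
  have h2 : npow Y 2 = mul Y Y := congrArg (fun Z => mul Z Y) h1
  rw [h1, h2]
  simp [npow]

theorem exp_eq_of_ne {Y : Elt M τ} (hY : IsReduced Y) {a b : Fin 2} {k : ℕ}
    (h : ¬(a = 0 ∧ b = 0 ∧ k = 0)) (h' : ¬(a = 1 ∧ b = 1 ∧ k = 2)) {i : τ.Index}
    (hi : i ∈ τ.dom) : exp Y a b k i = Y a b k i := by
  rw [exp_eq hY a b k hi, one_eq_zero h, hY.mul_eq_zero h' hi, smul_zero, add_zero, zero_add]

theorem exp_one_one_two {Y : Elt M τ} (hY : IsReduced Y) {i : τ.Index} (hi : i ∈ τ.dom) :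
    exp Y 1 1 2 i = Y 1 1 2 i -
      τ.lift (wedgeForm (rfl : 1 + 1 = 2)) (Y 1 0 1) (Y 0 1 1) i := by
  rw [exp_eq hY 1 1 2 hi, one_eq_zero (by simp), mul_one_one_two hY hi, zero_add, smul_smul]
  have h : (2⁻¹ : ℝ) * (-2) = -1 := by norm_num
  rw [h, sub_eq_add_neg]
  exact congrArg (Y 1 1 2 i + ·)
    (neg_one_smul ℝ (τ.lift (wedgeForm (rfl : 1 + 1 = 2)) (Y 1 0 1) (Y 0 1 1) i))

theorem exp_zero_zero {Y : Elt M τ} (hY : IsReduced Y) (k : ℕ) {i : τ.Index} (hi : i ∈ τ.dom) :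
    exp Y 0 0 k i = (one : Elt M τ) 0 0 k i := by
  rw [exp_eq hY 0 0 k hi, hY i hi 0 0 k (Or.inr ⟨rfl, rfl⟩), hY.mul_eq_zero (by simp) hi, smul_zero,
    add_zero, add_zero]

/-- Closedness of the exponential of a reduced element, in terms of its components. -/
theorem closed_iff [IsManifold (𝓡 3) ∞ M] [IsContMDiffRiemannianBundle (𝓡 3) ∞ (EuclideanSpace ℝ (Fin 3))
      (fun x : M => TangentSpace (𝓡 3) x)]
    (o : ∀ x : M, Orientation ℝ (TangentSpace (𝓡 3) x) (Fin 3)) {Y : Elt M τ}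
    (hY : IsReduced Y) :
    (∀ i ∈ τ.dom, ∀ a b k, diff o (exp Y) a b k i = 0) ↔
      ∀ i ∈ τ.dom, codiff o (Y 1 0 1 i) = 0 ∧ codiff o (Y 0 1 1 i) = 0 ∧
        codiff o (Y 1 1 2 i - τ.lift (wedgeForm (rfl : 1 + 1 = 2)) (Y 1 0 1) (Y 0 1 1) i) -
          τ.ddt (Y 0 1 1) i = 0 := by
  have d10 : ∀ i ∈ τ.dom, ∀ k, diff o (exp Y) 1 0 k i = codiff o (Y 1 0 (k + 1) i) := by
    intro i hi k
    -- The parameter-free part of the exponential is the constant 1, so d t = dt contributes nothing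
    -- to this component.
    have h1 : τ.ddt (exp Y 0 0 k) i = 0 := by
      rw [TimeDomain.ddt_congr (fun j hj => exp_zero_zero hY k hj) hi]
      cases k with
      | zero => exact TimeDomain.ddt_const _ i
      | succ k =>
        rw [one_eq_zero (by simp)]
        exact TimeDomain.ddt_zero i
    simp only [diff, if_true]
    rw [h1, smul_zero, add_zero, exp_eq_of_ne hY (by simp) (by simp) hi]
  have d01 : ∀ i ∈ τ.dom, ∀ k, diff o (exp Y) 0 1 k i = codiff o (Y 0 1 (k + 1) i) := by
    intro i hi k
    simp only [diff, zero_ne_one, if_false, add_zero]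
    rw [exp_eq_of_ne hY (by simp) (by simp) hi]
  have d00 : ∀ i ∈ τ.dom, ∀ k, diff o (exp Y) 0 0 k i = 0 := by
    intro i hi k
    simp only [diff, zero_ne_one, if_false, add_zero]
    rw [exp_zero_zero hY _ hi, one_eq_zero (by simp)]
    exact codiff_zero
  have hddt : ∀ i ∈ τ.dom, ∀ k, τ.ddt (exp Y 0 1 k) i = τ.ddt (Y 0 1 k) i := fun i hi k =>
    TimeDomain.ddt_congr (fun j hj => exp_eq_of_ne hY (by simp) (by simp) hj) hi
  have d11 : ∀ i ∈ τ.dom, diff o (exp Y) 1 1 1 i =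
      codiff o (Y 1 1 2 i - τ.lift (wedgeForm (rfl : 1 + 1 = 2)) (Y 1 0 1) (Y 0 1 1) i) -
          τ.ddt (Y 0 1 1) i := by
    intro i hi
    simp only [diff, if_true]
    rw [hddt i hi, ← exp_one_one_two hY hi, pow_one, sub_eq_add_neg]
    exact congrArg (codiff o (exp Y 1 1 2 i) + ·) (neg_one_smul ℝ (show Form M 1 from τ.ddt (Y 0 1 1) i))
  -- Outside form degree 1, both Y 1 1 (k + 1) and Y 0 1 k vanish for degree reasons.
  have d11' : ∀ i ∈ τ.dom, ∀ k, k ≠ 1 → diff o (exp Y) 1 1 k i = 0 := by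
    intro i hi k hk
    have h1 : τ.ddt (Y 0 1 k) i = 0 := by
      rw [TimeDomain.ddt_congr (fun j hj => hY j hj 0 1 k (Or.inl (by simpa using hk))) hi]
      exact TimeDomain.ddt_zero i
    simp only [diff, if_true]
    rw [hddt i hi, h1, smul_zero, add_zero, exp_eq_of_ne hY (by simp) (by simp; omega) hi,
      hY i hi 1 1 (k + 1) (Or.inl (by simp; omega))]
    exact codiff_zero
  constructor
  · intro h i hi
    exact ⟨(d10 i hi 0).symm.trans (h i hi 1 0 0), (d01 i hi 0).symm.trans (h i hi 0 1 0),
      (d11 i hi).symm.trans (h i hi 1 1 1)⟩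
  · intro h i hi a b k
    obtain ⟨h1, h2, h3⟩ := h i hi
    have hz : ∀ a b : Fin 2, (a : ℕ) + (b : ℕ) = 1 → ∀ k, k ≠ 0 → Y a b (k + 1) i = 0 :=
      fun a b hab k hk => hY i hi a b _ (Or.inl (by omega))
    fin_cases a <;> fin_cases b
    · exact d00 i hi k
    · refine (d01 i hi k).trans ?_
      by_cases hk : k = 0
      · subst hk; exact h2
      · rw [hz 0 1 rfl k hk]; exact codiff_zero
    · refine (d10 i hi k).trans ?_
      by_cases hk : k = 0
      · subst hk; exact h1
      · rw [hz 1 0 rfl k hk]; exact codiff_zero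
    · by_cases hk : k = 1
      · subst hk; exact (d11 i hi).trans h3
      · exact d11' i hi k hk

end Elt

end

/-! ### Regularity and coclosedness of the constraints -/

section

variable {M : Type*} [TopologicalSpace M] [ChartedSpace (EuclideanSpace ℝ (Fin 3)) M]

section Smoothness

theorem jointForm_zero {J : Set ℝ} {k : ℕ} : JointForm J (fun _ => (0 : Form M k)) :=
  fun _ _ => contDiffOn_const (c := (0 : ℝ))

theorem isSmoothForm_zero {k : ℕ} : IsSmoothForm (0 : Form M k) :=
  (jointForm_zero (J := Set.univ)).isSmoothForm (Set.mem_univ 0)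

theorem isSmoothForm_smul {k : ℕ} (c : ℝ) {α : Form M k} (hα : IsSmoothForm α) :
    IsSmoothForm (c • α) :=
  (jointForm_smul (J := Set.univ) c hα.jointForm).isSmoothForm (Set.mem_univ 0)

theorem isSmoothForm_sum {k : ℕ} {ι : Type*} (s : Finset ι) {a : ι → Form M k}
    (ha : ∀ i ∈ s, IsSmoothForm (a i)) : IsSmoothForm (∑ i ∈ s, a i) :=
  (jointForm_sum (J := Set.univ) s (a := fun i _ => a i)
    fun i hi => (ha i hi).jointForm).isSmoothForm (Set.mem_univ 0)

namespace TimeDomain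

theorem evalTimes_subset_dom (τ : TimeDomain) : τ.evalTimes ⊆ τ.dom := by
  cases τ with
  | point => exact fun _ h => h
  | formal => exact fun _ _ => trivial
  | interval J => exact fun _ h => h

theorem IsTime.uniqueDiffOn {J : Set ℝ} (h : (interval J).IsTime) : UniqueDiffOn ℝ J :=
  uniqueDiffOn_convex h.1 h.2

theorem SmoothForm.isSmoothForm {τ : TimeDomain} {k : ℕ} {a : τ.Index → Form M k}
    (ha : τ.SmoothForm a) {i : τ.Index} (hi : i ∈ τ.dom) : IsSmoothForm (a i) := by
  cases τ with
  | point => exact ha i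
  | formal => exact ha i
  | interval J => exact (jointForm_iff.2 ha).isSmoothForm hi

theorem smoothForm_zero {τ : TimeDomain} {k : ℕ} : τ.SmoothForm (fun _ => (0 : Form M k)) := by
  cases τ with
  | point => exact fun _ => isSmoothForm_zero
  | formal => exact fun _ => isSmoothForm_zero
  | interval J => exact jointForm_iff.1 jointForm_zero

end TimeDomain

variable [IsManifold (𝓡 3) ∞ M]

theorem isSmoothVField_iff {u : VField M} : IsSmoothVField u ↔
    ContMDiff (𝓡 3) (𝓡 3).tangent ∞ (fun x => (⟨x, u x⟩ : TangentBundle (𝓡 3) M)) := by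
  constructor
  · intro h
    -- The static statement is the time-dependent one for a constant field, restricted to the slice
    -- t = 0.
    have h1 := (smoothVField_interval_iff (J := Set.univ) (u := fun _ : ℝ => u)).2
      (show JointVField Set.univ (fun _ : ℝ => u) from h.jointVField)
    intro x
    have h2 := (h1 ((0 : ℝ), x) ⟨trivial, trivial⟩).contMDiffAt (by simp)
    exact h2.comp x (contMDiffAt_const.prodMk contMDiffAt_id)
  · intro h
    have h1 : (TimeDomain.interval Set.univ).SmoothVField (fun _ : ℝ => u) :=
      (h.comp contMDiff_snd).contMDiffOn
    exact (show JointVField Set.univ (fun _ => u) from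
      smoothVField_interval_iff.1 h1).isSmoothVField (Set.mem_univ 0)

theorem TimeDomain.SmoothVField.isSmoothVField {τ : TimeDomain} {u : τ.Index → VField M}
    (hu : τ.SmoothVField u) {i : τ.Index} (hi : i ∈ τ.dom) : IsSmoothVField (u i) := by
  cases τ with
  | point => exact isSmoothVField_iff.2 (hu i)
  | formal => exact isSmoothVField_iff.2 (hu i)
  | interval J =>
    exact (show JointVField J u from smoothVField_interval_iff.1 hu).isSmoothVField hi

variable [Bundle.RiemannianBundle (fun x : M => TangentSpace (𝓡 3) x)]
  [IsContMDiffRiemannianBundle (𝓡 3) ∞ (EuclideanSpace ℝ (Fin 3))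
      (fun x : M => TangentSpace (𝓡 3) x)]
  {o : ∀ x : M, Orientation ℝ (TangentSpace (𝓡 3) x) (Fin 3)} {τ : TimeDomain}

theorem TimeDomain.smoothForm_flat {u : τ.Index → VField M} (hu : τ.SmoothVField u) :
    τ.SmoothForm (fun i => flat (u i)) := by
  cases τ with
  | point => exact fun i => isSmoothForm_flat (isSmoothVField_iff.2 (hu i))
  | formal => exact fun i => isSmoothForm_flat (isSmoothVField_iff.2 (hu i))
  | interval J => exact jointForm_iff.1 (jointForm_flat (smoothVField_interval_iff.1 hu))

theorem TimeDomain.smoothVField_sharp {a : τ.Index → Form M 1} (ha : τ.SmoothForm a) :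
    τ.SmoothVField (fun i => sharp (a i)) := by
  cases τ with
  | point => exact fun i => isSmoothVField_iff.1 (isSmoothVField_sharp (ha i))
  | formal => exact fun i => isSmoothVField_iff.1 (isSmoothVField_sharp (ha i))
  | interval J => exact smoothVField_interval_iff.2 (jointVField_sharp (jointForm_iff.2 ha))

theorem vorticityForm_eq (X : τ.Index → Form M 1) (i : τ.Index) :
    vorticityForm o τ X i = (-1 : ℝ) • star o (rfl : 1 + 2 = 3) (extD (X i)) :=
  (neg_one_smul ℝ (star o (rfl : 1 + 2 = 3) (extD (X i)))).symm

theorem smoothForm_vorticityForm (ho : IsSmoothForm (volForm o)) (hτ : τ.IsTime)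
    {X : τ.Index → Form M 1} (hX : τ.SmoothForm X) : τ.SmoothForm (vorticityForm o τ X) := by
  rw [funext (vorticityForm_eq (o := o) X)]
  cases τ with
  | point => exact hτ.elim
  | formal =>
    exact fun n => isSmoothForm_smul _ (isSmoothForm_star_two ho _ (isSmoothForm_extD (hX n)))
  | interval J =>
    exact jointForm_iff.1 (jointForm_smul _ (jointForm_star_two ho _
      (jointForm_extD hτ.uniqueDiffOn (jointForm_iff.2 hX))))

/-- `X ∧ ⋆X` for a time-dependent one-form. -/
def energyForm (o : ∀ x : M, Orientation ℝ (TangentSpace (𝓡 3) x) (Fin 3)) (τ : TimeDomain)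
    (X : τ.Index → Form M 1) : τ.Index → Form M 3 :=
  τ.lift (fun α β : Form M 1 =>
      wedgeForm (show 1 + 2 = 3 from rfl) α (star o (show 2 + 1 = 3 from rfl) β)) X X

theorem isSmoothForm_energyForm (ho : IsSmoothForm (volForm o)) {X : τ.Index → Form M 1}
    (hX : τ.SmoothForm X) {i : τ.Index} (hi : i ∈ τ.dom) :
    IsSmoothForm (energyForm o τ X i) := by
  rw [energyForm, TimeDomain.lift_eq_sum]
  refine isSmoothForm_sum _ fun p hp => ?_
  obtain ⟨h1, h2⟩ := TimeDomain.mem_dom_of_mem_pairs hi hp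
  exact isSmoothForm_wedge _ (hX.isSmoothForm h1) (isSmoothForm_star_one ho _ (hX.isSmoothForm h2))

theorem isSmoothForm_kinetic (ho : IsSmoothForm (volForm o)) {X : τ.Index → Form M 1}
    (hX : τ.SmoothForm X) {i : τ.Index} (hi : i ∈ τ.dom) : IsSmoothForm (kinetic o τ X i) :=
  isSmoothForm_smul _ ((jointForm_codiff_three ho uniqueDiffOn_univ
    (isSmoothForm_energyForm ho hX hi).jointForm).isSmoothForm (Set.mem_univ 0))

theorem smoothForm_kinetic (ho : IsSmoothForm (volForm o)) (hτ : τ.IsTime)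
    {X : τ.Index → Form M 1} (hX : τ.SmoothForm X) : τ.SmoothForm (kinetic o τ X) := by
  cases τ with
  | point => exact hτ.elim
  | formal => exact fun n => isSmoothForm_kinetic ho hX trivial
  | interval J =>
    have h := jointForm_iff.2 hX
    exact jointForm_iff.1 (jointForm_smul _ (jointForm_codiff_three ho hτ.uniqueDiffOn
      (jointForm_wedge _ h (jointForm_star_one ho _ h))))

/-- Coexact forms are coclosed, so π drops out of the dt ε equation once it satisfies the kinetic
constraint. -/
theorem codiff_kinetic (ho : IsSmoothForm (volForm o)) {X : τ.Index → Form M 1}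
    (hX : τ.SmoothForm X) {i : τ.Index} (hi : i ∈ τ.dom) : codiff o (kinetic o τ X i) = 0 := by
  have h : codiff o (codiff o (energyForm o τ X i)) = 0 :=
    codiff_codiff_three ho (isSmoothForm_energyForm ho hX hi)
  exact (codiff_smul _ _).trans (by rw [← energyForm, h, smul_zero])

theorem codiff_vorticityForm {X : τ.Index → Form M 1} {i : τ.Index} (hX : IsSmoothForm (X i)) :
    codiff o (vorticityForm o τ X i) = 0 := by
  rw [vorticityForm_eq, codiff_smul, codiff_star_extD _ hX, smul_zero]

end Smoothness

/-! ### Time derivatives and the musical isomorphism -/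

section Derivative

/-- The left inverse K spares any differentiability hypothesis: if f is not differentiable, neither
is L ∘ f, and both derivatives take the default value 0. -/
theorem derivWithin_clm_comp {F G : Type*} [NormedAddCommGroup F] [NormedSpace ℝ F]
    [NormedAddCommGroup G] [NormedSpace ℝ G] (L : F →L[ℝ] G) (K : G →L[ℝ] F)
    (h : ∀ v, K (L v) = v) {f : ℝ → F} {J : Set ℝ} {t : ℝ} (ht : UniqueDiffWithinAt ℝ J t) :
    derivWithin (fun s => L (f s)) J t = L (derivWithin f J t) := by
  by_cases hf : DifferentiableWithinAt ℝ f J t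
  · exact (L.hasFDerivAt.comp_hasDerivWithinAt t hf.hasDerivWithinAt).derivWithin ht
  · have hg : ¬DifferentiableWithinAt ℝ (fun s => L (f s)) J t := fun hg => by
      apply hf
      have h1 := K.differentiableAt.comp_differentiableWithinAt t hg
      exact h1.congr (fun s _ => (h _).symm) (h _).symm
    rw [derivWithin_zero_of_not_differentiableWithinAt hf,
      derivWithin_zero_of_not_differentiableWithinAt hg, map_zero]

section Musical

variable {T ι : Type*} [NormedAddCommGroup T] [InnerProductSpace ℝ T]

/-- The musical isomorphism of an inner product space. -/
def flatMap (T : Type*) [NormedAddCommGroup T] [InnerProductSpace ℝ T] :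
    T →L[ℝ] T [⋀^Fin 1]→L[ℝ] ℝ :=
  LinearMap.mkContinuous
    { toFun := fun v => ContinuousAlternatingMap.ofSubsingleton ℝ T ℝ (0 : Fin 1) (innerSL ℝ v)
      map_add' := fun v w => by ext z; exact inner_add_left v w (z 0)
      map_smul' := fun c v => by ext z; exact real_inner_smul_left v (z 0) c } 1 fun v => by
    rw [one_mul]
    refine ContinuousAlternatingMap.opNorm_le_bound _ (norm_nonneg v) fun z => ?_
    simpa using norm_inner_le_norm (𝕜 := ℝ) v (z 0)

/-- The inverse of the musical isomorphism, in terms of an orthonormal basis. -/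
def sharpMap [Fintype ι] (e : OrthonormalBasis ι ℝ T) : (T [⋀^Fin 1]→L[ℝ] ℝ) →L[ℝ] T :=
  ∑ i, (ContinuousAlternatingMap.apply ℝ T ℝ (fun _ : Fin 1 => e i)).smulRight (e i)

theorem sharpMap_flatMap [Fintype ι] (e : OrthonormalBasis ι ℝ T) (v : T) :
    sharpMap e (flatMap T v) = v := by
  have h2 : sharpMap e (flatMap T v) = ∑ i, inner ℝ v (e i) • e i := by
    rw [sharpMap, sum_apply]
    rfl
  rw [h2]
  simpa only [real_inner_comm] using e.sum_repr' v

theorem derivWithin_neg_flatMap [Fintype ι] (e : OrthonormalBasis ι ℝ T) (f : ℝ → T) {J : Set ℝ}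
    {t : ℝ} (ht : UniqueDiffWithinAt ℝ J t) :
    derivWithin (fun s => -flatMap T (f s)) J t = -flatMap T (derivWithin f J t) :=
  derivWithin_clm_comp (-flatMap T) (-sharpMap e) (fun v => by
    rw [neg_apply, neg_apply, map_neg, neg_neg, sharpMap_flatMap]) ht

end Musical

variable [Bundle.RiemannianBundle (fun x : M => TangentSpace (𝓡 3) x)]

theorem flat_add (u w : VField M) : flat (u + w) = flat u + flat w := by
  funext x; ext v
  exact inner_add_left (u x) (w x) (v 0)

theorem flat_injective : Function.Injective (flat : VField M → Form M 1) :=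
  Function.LeftInverse.injective sharp_flat

theorem flat_sum {ι : Type*} (s : Finset ι) (u : ι → VField M) :
    flat (∑ i ∈ s, u i) = ∑ i ∈ s, flat (u i) :=
  map_sum (AddMonoidHom.mk' flat flat_add) u s

/-- The metric is independent of time, so at a fixed point ♭ is a fixed invertible linear map and
commutes with the time derivative. -/
theorem TimeDomain.ddt_neg_flat {τ : TimeDomain} (hτ : τ.IsTime) (w : τ.Index → VField M)
    {i : τ.Index} (hi : i ∈ τ.dom) :
    τ.ddt (fun j => -flat (w j)) i = -flat (τ.ddt w i) := by
  cases τ with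
  | point => exact hτ.elim
  | formal =>
    funext x
    ext v
    have h : ∀ (c : ℝ) (a : TangentSpace (𝓡 3) x) , c * -inner ℝ a (v 0) = -inner ℝ (c • a) (v 0) :=
      fun c a => by rw [real_inner_smul_left]; ring
    exact h _ _
  | interval J =>
    funext x
    exact derivWithin_neg_flatMap (frame x) (fun s : ℝ => w s x) (hτ.uniqueDiffOn i hi)

end Derivative

end

/-! ### Equivalence of the closedness equations with the vorticity equations -/

section

theorem TimeDomain.lift_congr {A B C : Type*} [AddCommMonoid C] {op : A → B → C} {τ : TimeDomain}
    {a a' : τ.Index → A} {b b' : τ.Index → B} (ha : ∀ i ∈ τ.dom, a i = a' i)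
    (hb : ∀ i ∈ τ.dom, b i = b' i) {i : τ.Index} (hi : i ∈ τ.dom) :
    τ.lift op a b i = τ.lift op a' b' i := by
  rw [lift_eq_sum, lift_eq_sum]
  refine Finset.sum_congr rfl fun p hp => ?_
  obtain ⟨h1, h2⟩ := mem_dom_of_mem_pairs hi hp
  rw [ha _ h1, hb _ h2]

variable {M : Type*} [TopologicalSpace M] [ChartedSpace (EuclideanSpace ℝ (Fin 3)) M]
  {τ : TimeDomain}

namespace Elt

theorem ofComponents_of_ne {f : τ.Index → Form M 0} {X V : τ.Index → Form M 1}
    {P : τ.Index → Form M 2} {a b : Fin 2} {k : ℕ} (h : k ≠ (a : ℕ) + (b : ℕ)) :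
    ofComponents f X V P a b k = fun _ => 0 := by
  unfold ofComponents
  split <;> first | rfl | exact absurd rfl h

theorem smoothForm_ofComponents {f : τ.Index → Form M 0} {X V : τ.Index → Form M 1}
    {P : τ.Index → Form M 2} (hf : τ.SmoothForm f) (hX : τ.SmoothForm X) (hV : τ.SmoothForm V)
    (hP : τ.SmoothForm P) (a b : Fin 2) (k : ℕ) : τ.SmoothForm (ofComponents f X V P a b k) := by
  unfold ofComponents
  split
  exacts [hf, hX, hV, hP, TimeDomain.smoothForm_zero]

theorem isReduced_ofComponents (X V : τ.Index → Form M 1) (P : τ.Index → Form M 2) :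
    IsReduced (ofComponents (fun _ => 0) X V P) := by
  rintro i - a b k (h | ⟨rfl, rfl⟩)
  · rw [ofComponents_of_ne h]
  · by_cases h : k = 0
    · subst h; rfl
    · rw [ofComponents_of_ne h]

theorem IsReduced.slice {Y : Elt M τ} (hY : IsReduced Y) {s : τ.Index} (hs : s ∈ τ.dom) :
    IsReduced (Y.slice s) := by
  intro i _ a b k h
  by_cases ha : a = 0
  · subst ha
    exact hY s hs 0 b k h
  · exact if_neg ha

end Elt

variable [IsManifold (𝓡 3) ∞ M] [Bundle.RiemannianBundle (fun x : M => TangentSpace (𝓡 3) x)]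
  [IsContMDiffRiemannianBundle (𝓡 3) ∞ (EuclideanSpace ℝ (Fin 3))
      (fun x : M => TangentSpace (𝓡 3) x)]
  {o : ∀ x : M, Orientation ℝ (TangentSpace (𝓡 3) x) (Fin 3)}

theorem codiff_two_add (ho : IsSmoothForm (volForm o)) {α β : Form M 2} (hα : IsSmoothForm α)
    (hβ : IsSmoothForm β) : codiff o (α + β) = codiff o α + codiff o β := by
  have h := codiff_two_sum ho Finset.univ (a := ![α, β])
    (fun i _ => by fin_cases i <;> assumption)
  simpa [Fin.sum_univ_two] using h

theorem vorticityForm_flat (u : τ.Index → VField M) (i : τ.Index) :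
    vorticityForm o τ (fun j => flat (u j)) i = -flat (curl o (u i)) := by
  rw [curl, flat_sharp]
  rfl

/-- The `dt ε` component of the closedness equation, for a divergence-free velocity field. -/
theorem codiff_kinetic_sub_lift (ho : IsSmoothForm (volForm o)) {u : τ.Index → VField M}
    (hu : τ.SmoothVField u) (hdiv : ∀ i ∈ τ.dom, divergence o (u i) = 0) {i : τ.Index}
    (hi : i ∈ τ.dom) :
    codiff o (kinetic o τ (fun j => flat (u j)) i - τ.lift (wedgeForm (rfl : 1 + 1 = 2))
        (fun j => flat (u j)) (vorticityForm o τ (fun j => flat (u j))) i) =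
      -flat (τ.lift covD (fun j => curl o (u j)) u i -
        τ.lift covD u (fun j => curl o (u j)) i) := by
  have hs : ∀ j ∈ τ.dom, IsSmoothVField (u j) := fun j hj => hu.isSmoothVField hj
  have hc : ∀ j ∈ τ.dom, IsSmoothVField (curl o (u j)) := fun j hj =>
    isSmoothVField_curl ho (hs j hj)
  have hw : ∀ p ∈ τ.pairs i, IsSmoothForm
      (wedgeForm (rfl : 1 + 1 = 2) (flat (u p.1)) (flat (curl o (u p.2)))) := fun p hp =>
    isSmoothForm_wedge _ (isSmoothForm_flat (hs _ (TimeDomain.mem_dom_of_mem_pairs hi hp).1))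
      (isSmoothForm_flat (hc _ (TimeDomain.mem_dom_of_mem_pairs hi hp).2))
  simp only [TimeDomain.lift_eq_sum, vorticityForm_flat, wedgeForm_neg_right,
    Finset.sum_neg_distrib, sub_neg_eq_add]
  -- The wedge takes u at the first index of a pair and ω at the second, while ∇_ω u has them the
  -- other way round. Its sum is swapped so that the two sides agree term by term.
  rw [codiff_two_add ho (isSmoothForm_kinetic ho (TimeDomain.smoothForm_flat hu) hi)
    (isSmoothForm_sum _ hw), codiff_kinetic ho (TimeDomain.smoothForm_flat hu) hi, zero_add,
    codiff_two_sum ho _ hw,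
    TimeDomain.sum_pairs_swap i (fun j l => covD (curl o (u j)) (u l)),
    ← Finset.sum_sub_distrib, flat_sum, ← Finset.sum_neg_distrib]
  refine Finset.sum_congr rfl fun p hp => ?_
  obtain ⟨h1, h2⟩ := TimeDomain.mem_dom_of_mem_pairs hi hp
  exact codiff_wedge_flat ho _ (hs _ h1) (hc _ h2) (hdiv _ h1) (divergence_curl (hs _ h2))

/-- The `dt ε` component of the closedness equation is the vorticity equation. -/
theorem closed_dt_eps_iff (ho : IsSmoothForm (volForm o)) (hτ : τ.IsTime) {u : τ.Index → VField M}
    (hu : τ.SmoothVField u) (hdiv : ∀ i ∈ τ.dom, divergence o (u i) = 0) {i : τ.Index}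
    (hi : i ∈ τ.dom) :
    codiff o (kinetic o τ (fun j => flat (u j)) i - τ.lift (wedgeForm (rfl : 1 + 1 = 2))
        (fun j => flat (u j)) (vorticityForm o τ (fun j => flat (u j))) i) -
      τ.ddt (vorticityForm o τ (fun j => flat (u j))) i = 0 ↔
    τ.ddt (fun j => curl o (u j)) i = τ.lift covD (fun j => curl o (u j)) u i -
      τ.lift covD u (fun j => curl o (u j)) i := by
  rw [codiff_kinetic_sub_lift ho hu hdiv hi, funext (vorticityForm_flat (o := o) u),
    TimeDomain.ddt_neg_flat hτ _ hi, sub_eq_zero, neg_inj, flat_injective.eq_iff, eq_comm]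

theorem fluidElt_one_zero_one (u : τ.Index → VField M) :
    fluidElt o τ u 1 0 1 = fun i => flat (u i) := rfl

theorem fluidElt_zero_one_one (u : τ.Index → VField M) :
    fluidElt o τ u 0 1 1 = vorticityForm o τ (fun i => flat (u i)) := rfl

theorem fluidElt_one_one_two (u : τ.Index → VField M) :
    fluidElt o τ u 1 1 2 = kinetic o τ (fun i => flat (u i)) := rfl

/-- At dt = 0 only V ε is left, so the exponential is 1 + V ε and its closedness is δV = 0, which
holds for every u by d² = 0. -/
theorem isCollection_slice_fluidElt (ho : IsSmoothForm (volForm o)) (hτ : τ.IsTime)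
    {u : τ.Index → VField M} (hu : τ.SmoothVField u) {s : τ.Index} (hs : s ∈ τ.dom) :
    IsCollection o TimeDomain.point ((fluidElt o τ u).slice s) := by
  have hX := TimeDomain.smoothForm_flat hu
  have hr : Elt.IsReduced (fluidElt o τ u) := Elt.isReduced_ofComponents _ _ _
  have hr' := hr.slice hs
  refine ⟨fun a b k i => ?_, fun _ b k i => if_neg one_ne_zero,
    fun i hi a b k h => hr' i hi a b k (Or.inl h), (Elt.closed_iff o hr').2 fun i _ => ?_⟩
  · by_cases ha : a = 0
    · subst ha
      exact (Elt.smoothForm_ofComponents TimeDomain.smoothForm_zero hX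
        (smoothForm_vorticityForm ho hτ hX) (smoothForm_kinetic ho hτ hX) 0 b k).isSmoothForm hs
    · have h : (fluidElt o τ u).slice s a b k i = 0 := if_neg ha
      rw [h]
      exact isSmoothForm_zero
  · have h1 : ∀ b k, (fluidElt o τ u).slice s 1 b k = fun _ => 0 := fun b k =>
      funext fun _ => if_neg one_ne_zero
    have h2 : TimeDomain.point.lift (wedgeForm (rfl : 1 + 1 = 2)) (fun _ => (0 : Form M 1))
        ((fluidElt o τ u).slice s 0 1 1) i = 0 := wedgeForm_zero_left _ _
    have h3 : TimeDomain.point.ddt ((fluidElt o τ u).slice s 0 1 1) i = 0 := rfl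
    simp only [h1]
    rw [h2, h3, sub_zero, sub_zero, codiff_zero, codiff_zero]
    have h4 : (fluidElt o τ u).slice s 0 1 1 i = vorticityForm o τ (fun j => flat (u j)) s := by
      rw [← fluidElt_zero_one_one]
      exact if_pos rfl
    rw [h4]
    exact ⟨rfl, codiff_vorticityForm (hX.isSmoothForm hs), rfl⟩

theorem IsVorticitySolution.isHomotopy (ho : IsSmoothForm (volForm o)) (hτ : τ.IsTime)
    {u : τ.Index → VField M} (hu : IsVorticitySolution o τ u) :
    IsHomotopy o τ (fluidElt o τ u) := by
  have hX := TimeDomain.smoothForm_flat hu.smooth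
  have hr : Elt.IsReduced (fluidElt o τ u) := Elt.isReduced_ofComponents _ _ _
  refine ⟨⟨Elt.smoothForm_ofComponents TimeDomain.smoothForm_zero hX
    (smoothForm_vorticityForm ho hτ hX) (smoothForm_kinetic ho hτ hX), ?_,
    fun i hi a b k h => hr i hi a b k (Or.inl h), (Elt.closed_iff o hr).2 fun i hi => ?_⟩,
    fun s hs => isCollection_slice_fluidElt ho hτ hu.smooth (τ.evalTimes_subset_dom hs)⟩
  · rintro rfl
    exact hτ.elim
  · rw [fluidElt_one_zero_one, fluidElt_zero_one_one, fluidElt_one_one_two]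
    exact ⟨hu.mass i hi, codiff_vorticityForm (hX.isSmoothForm hi),
      (closed_dt_eps_iff ho hτ hu.smooth hu.mass hi).2 (hu.vorticity i hi)⟩

theorem IsCollection.isReduced {Y : Elt M τ} (hY : IsCollection o τ Y)
    (hf : ∀ i ∈ τ.dom, Y 0 0 0 i = 0) : Elt.IsReduced Y := by
  rintro i hi a b k (h | ⟨rfl, rfl⟩)
  · exact hY.degree_zero i hi a b k h
  · by_cases h : k = 0
    · subst h; exact hf i hi
    · exact hY.degree_zero i hi 0 0 k h

theorem IsCollection.eq_fluidElt {Y : Elt M τ} (hY : IsCollection o τ Y) (hf : ∀ i ∈ τ.dom, Y 0 0 0 i = 0)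
    (hV : ∀ i ∈ τ.dom, Y 0 1 1 i = vorticityForm o τ (Y 1 0 1) i)
    (hP : ∀ i ∈ τ.dom, Y 1 1 2 i = kinetic o τ (Y 1 0 1) i) {i : τ.Index} (hi : i ∈ τ.dom)
    (a b : Fin 2) (k : ℕ) : Y a b k i = fluidElt o τ (fun j => sharp (Y 1 0 1 j)) a b k i := by
  by_cases h : k = (a : ℕ) + (b : ℕ)
  · subst h
    simp only [fluidElt, flat_sharp]
    fin_cases a <;> fin_cases b
    exacts [hf i hi, hV i hi, rfl, hP i hi]
  · rw [hY.degree_zero i hi a b k h, fluidElt, Elt.ofComponents_of_ne h]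

theorem IsCollection.isVorticitySolution (ho : IsSmoothForm (volForm o)) (hτ : τ.IsTime)
    {Y : Elt M τ} (hY : IsCollection o τ Y) (hf : ∀ i ∈ τ.dom, Y 0 0 0 i = 0)
    (hV : ∀ i ∈ τ.dom, Y 0 1 1 i = vorticityForm o τ (Y 1 0 1) i)
    (hP : ∀ i ∈ τ.dom, Y 1 1 2 i = kinetic o τ (Y 1 0 1) i) :
    IsVorticitySolution o τ (fun i => sharp (Y 1 0 1 i)) := by
  have hu : τ.SmoothVField (fun i => sharp (Y 1 0 1 i)) :=
    TimeDomain.smoothVField_sharp (hY.smooth 1 0 1)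
  have hc := (Elt.closed_iff o (hY.isReduced hf)).1 hY.closed
  have hdiv : ∀ i ∈ τ.dom, divergence o (sharp (Y 1 0 1 i)) = 0 := fun i hi => by
    rw [divergence, flat_sharp]
    exact (hc i hi).1
  refine ⟨hu, hdiv, fun i hi => (closed_dt_eps_iff ho hτ hu hdiv hi).1 ?_⟩
  have h := (hc i hi).2.2
  -- The constraints hold only at indices in `dom`; they may be used inside the product and the time
  -- derivative because both depend on such indices alone.
  rw [hP i hi, TimeDomain.lift_congr (fun _ _ => rfl) hV hi, TimeDomain.ddt_congr hV hi] at h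
  simpa only [flat_sharp] using h

end

end HPT

end

theorem mainTheorem4 {M : Type*} [TopologicalSpace M]
    [ChartedSpace (EuclideanSpace ℝ (Fin 3)) M] [IsManifold (𝓡 3) ∞ M]
    [Bundle.RiemannianBundle (fun x : M => TangentSpace (𝓡 3) x)]
    [IsContMDiffRiemannianBundle (𝓡 3) ∞ (EuclideanSpace ℝ (Fin 3))
      (fun x : M => TangentSpace (𝓡 3) x)]
    (o : ∀ x : M, Orientation ℝ (TangentSpace (𝓡 3) x) (Fin 3))
    (ho : HPT.IsSmoothForm (HPT.volForm o))
    (τ : HPT.TimeDomain) (hτ : τ.IsTime) :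
    (∀ u : τ.Index → HPT.VField M, HPT.IsVorticitySolution o τ u →
      HPT.IsHomotopy o τ (HPT.fluidElt o τ u)) ∧
    (∀ Y : HPT.Elt M τ, HPT.IsHomotopy o τ Y →
      (∀ i ∈ τ.dom, Y 0 0 0 i = 0) →
      (∀ i ∈ τ.dom, Y 0 1 1 i = HPT.vorticityForm o τ (Y 1 0 1) i) →
      (∀ i ∈ τ.dom, Y 1 1 2 i = HPT.kinetic o τ (Y 1 0 1) i) →
      ∃ u : τ.Index → HPT.VField M, HPT.IsVorticitySolution o τ u ∧
        (∀ i ∈ τ.dom, u i = HPT.sharp (Y 1 0 1 i)) ∧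
        (∀ i ∈ τ.dom, ∀ a b k, Y a b k i = HPT.fluidElt o τ u a b k i)) :=
  ⟨fun _ hu => hu.isHomotopy ho hτ, fun Y hY hf hV hP => ⟨fun i => HPT.sharp (Y 1 0 1 i),
    hY.collection.isVorticitySolution ho hτ hf hV hP, fun _ _ => rfl,
    fun _ hi a b k => hY.collection.eq_fluidElt hf hV hP hi a b k⟩⟩
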